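/- For integers $n, m \ge 0$ let $p(n,m)$ be the number of (unordered) partitions of $n$ into exactly $m$ positive integer summands, and for $k \ge 1$ let $$t_k(n) = \sum_{m \ge 0} m^k\, p(n,m).$$ For $k \ge 1$ and real numbers $x_1,\dots,x_k$ write $$\Sigma(x_1,\dots,x_k) = \sum \frac{k!}{b_1!\,b_2!\cdots b_k!}\left(\frac{x_1}{1!}\right)^{b_1}\left(\frac{x_2}{2!}\right)^{b_2}\cdots\left(\frac{x_k}{k!}\right)^{b_k},$$ where the sum is over all $(b_1,\dots,b_k)$ of nonnegative integers with $b_1 + 2b_2 + \cdots + k b_k = k$. Let $\gamma$ be the Euler–Mascheroni constant and $\zeta$ the Riemann zeta function. Then, as $n \to \infty$, $$t_1(n) = \frac{\sqrt2}{4\pi\sqrt n}\, e^{\pi\sqrt{2n/3}}\left(\gamma + \log\frac{\sqrt{6n}}{\pi}\right)\left[1 + O(n^{-1/2})\right],$$ and for every integer $k \ge 2$, $$t_k(n) = \frac{1}{4\sqrt3\, n}\, e^{\pi\sqrt{2n/3}}\left(\frac{\sqrt{6n}}{\pi}\right)^{k} \Sigma\left(\gamma + \log\frac{\sqrt{6n}}{\pi},\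 \zeta(2),\ 2\zeta(3),\ \dots,\ (k-1)!\,\zeta(k)\right)\left[1 + O(n^{-1/2})\right],$$ where the constant implied by $O$ may depend on $k$. -/

import Mathlib

open Filter Asymptotics

namespace PartitionMoments

/-- The number `p(n, m)` of partitions of `n` into exactly `m` positive integer summands. -/
def partitionCount (n m : ℕ) : ℕ :=
  (Finset.univ.filter fun P : n.Partition => Multiset.card P.parts = m).card

/-- The `k`-th moment `t_k(n) = ∑_m m ^ k * p(n, m)`. The sum may stop at `m = n`, because
`p(n, m) = 0` for `m > n`. -/
def moment (k n : ℕ) : ℕ :=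
  ∑ m ∈ Finset.range (n + 1), m ^ k * partitionCount n m

/-- The solutions `(b_1, …, b_k)` in nonnegative integers of `b_1 + 2 b_2 + ⋯ + k b_k = k`;
the entry `b_{i+1}` is `b i` for `i : Fin k`. Each solution has all entries at most `k`. -/
def solutions (k : ℕ) : Finset (Fin k → ℕ) :=
  (Fintype.piFinset fun _ : Fin k => Finset.range (k + 1)).filter
    fun b => ∑ i : Fin k, ((i : ℕ) + 1) * b i = k

/-- The sum `Σ(x_1, …, x_k)` of
`k! / (b_1! ⋯ b_k!) * (x_1 / 1!) ^ b_1 * ⋯ * (x_k / k!) ^ b_k`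
over all solutions of `b_1 + 2 b_2 + ⋯ + k b_k = k`; the entry `x_{i+1}` is `x i`. -/
noncomputable def bellSum (k : ℕ) (x : Fin k → ℝ) : ℝ :=
  ∑ b ∈ solutions k,
    ((k.factorial : ℝ) / ∏ i : Fin k, ((b i).factorial : ℝ)) *
      ∏ i : Fin k, (x i / (((i : ℕ) + 1).factorial : ℝ)) ^ b i

/-- The arguments `(γ + log (√(6n) / π), ζ(2), 2 ζ(3), …, (k - 1)! ζ(k))`. The zeta values are
real, so taking real parts only moves them from `ℂ` to `ℝ`. -/
noncomputable def zetaArgs (k n : ℕ) (i : Fin k) : ℝ :=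
  if (i : ℕ) = 0 then
    Real.eulerMascheroniConstant + Real.log (Real.sqrt (6 * (n : ℝ)) / Real.pi)
  else ((i : ℕ).factorial : ℝ) * (riemannZeta (((i : ℕ) + 1 : ℕ) : ℂ)).re

/-- `f(n) = g(n) [1 + O(n^{-1/2})]` as `n → ∞`. -/
def EqOneAddBigO (f g : ℕ → ℝ) : Prop :=
  ∃ E : ℕ → ℝ, (E =O[atTop] fun n : ℕ => (n : ℝ) ^ (-(1 / 2) : ℝ)) ∧
    ∀ᶠ n : ℕ in atTop, f n = g n * (1 + E n)

end PartitionMoments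

/-!
Counting how often each value occurs as a summand gives `∑ t_k(n) q ^ n = B_k(L_0, L_1, …) P(q)`,
where `P` is the generating function of the numbers of partitions, `L_i = ∑ σ_i(n) q ^ n`, and `B_k`
is the complete Bell polynomial. Hence `t_k(n) = ∑ b_k(m) p(n - m)` with coefficients `b_k(m) ≥ 0`.

At the saddle point `t = π / √(6n)` one has `p(n - m) = A e ^ (-m t) (1 + O(t (1 + (m t) ^ 2)))`,
where `A` is the Hardy–Ramanujan main term: in Cauchy's formula on the circle `|q| = e ^ (-t)`, the
modular transformation of Dedekind's `η` describes `P` near `q = 1`, and elsewhere `P` is small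
compared with `P(|q|)`. Since `b_k(m) ≥ 0`, summing over `m` gives
`t_k(n) = A (B_k(L(e ^ (-t))) + O(t B_k(L(e ^ (-t / 2)))))`.

Finally `t ^ (i + 1) L_i(e ^ (-t))` is, up to `O(t)`, a Riemann sum for
`∫ x ^ i / (e ^ x - 1) = i! ζ(i + 1)` if `i ≥ 1`; for `i = 0` the pole of the integrand at `0`
produces the logarithm and Euler's constant.
-/

namespace PartitionMoments

section PartsRecurrence

open Finset

lemma card_parts_le {n : ℕ} (P : n.Partition) : P.parts.card ≤ n := by
  simpa [P.parts_sum] using Multiset.card_nsmul_le_sum (a := 1) fun i hi => P.parts_pos hi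

lemma moment_eq_sum_partition (k n : ℕ) : moment k n = ∑ P : n.Partition, P.parts.card ^ k := by
  rw [← sum_fiberwise_of_maps_to (t := range (n + 1)) (g := fun P : n.Partition => P.parts.card)
    fun P _ => mem_range_succ_iff.2 (card_parts_le P)]
  refine sum_congr rfl fun m _ => ?_
  rw [sum_congr rfl fun P hP => congrArg (· ^ k) (mem_filter.1 hP).2, sum_const, smul_eq_mul,
    mul_comm]
  rfl

lemma moment_zero (n : ℕ) : moment 0 n = Fintype.card n.Partition := by
  simp [moment_eq_sum_partition]

lemma mul_add_sum_sub_replicate {j m n : ℕ} {P : n.Partition} (h : m ≤ P.parts.count j) :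
    j * m + (P.parts - Multiset.replicate m j).sum = n := by
  have hsum := congrArg Multiset.sum
    (Multiset.sub_add_cancel (Multiset.le_count_iff_replicate_le.1 h))
  rw [Multiset.sum_add, P.parts_sum, Multiset.sum_replicate, smul_eq_mul] at hsum
  linarith

/-- The partition left after removing `m` copies of the part `j`. -/
def removeParts {j m r n : ℕ} (h : j * m + r = n) (P : n.Partition) (hP : m ≤ P.parts.count j) :
    r.Partition where
  parts := P.parts - Multiset.replicate m j
  parts_pos hi := P.parts_pos (Multiset.mem_of_le (Multiset.sub_le_self _ _) hi)
  parts_sum := by have := mul_add_sum_sub_replicate hP; omega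

/-- The partition obtained by adding `m` copies of the part `j`. -/
def addParts {j m r n : ℕ} (hj : 0 < j) (h : j * m + r = n) (P : r.Partition) : n.Partition where
  parts := P.parts + Multiset.replicate m j
  parts_pos hi := (Multiset.mem_add.1 hi).elim (fun hi => P.parts_pos hi)
    fun hi => Multiset.eq_of_mem_replicate hi ▸ hj
  parts_sum := by
    rw [Multiset.sum_add, P.parts_sum, Multiset.sum_replicate, smul_eq_mul]
    linarith

lemma sum_partition_count_ge {M : Type*} [AddCommMonoid M] {j m r n : ℕ} (hj : 0 < j)
    (h : j * m + r = n) (f : Multiset ℕ → M) :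
    ∑ P : n.Partition with m ≤ P.parts.count j, f P.parts =
      ∑ P : r.Partition, f (P.parts + Multiset.replicate m j) := by
  have hadd {P : n.Partition} (hP : P ∈ univ.filter fun P : n.Partition => m ≤ P.parts.count j) :
      P.parts - Multiset.replicate m j + Multiset.replicate m j = P.parts :=
    Multiset.sub_add_cancel (Multiset.le_count_iff_replicate_le.1 (mem_filter.1 hP).2)
  refine sum_bij' (fun P hP => removeParts h P (mem_filter.1 hP).2) (fun P _ => addParts hj h P)
    (fun _ _ => mem_univ _) (fun P _ => ?_) (fun P hP => ?_) (fun P _ => ?_) fun P hP => ?_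
  · simp [addParts]
  · exact Nat.Partition.ext (hadd hP)
  · exact Nat.Partition.ext Multiset.add_sub_cancel_right
  · exact congrArg f (hadd hP).symm

lemma card_parts_eq_card_filter {n : ℕ} (P : n.Partition) :
    P.parts.card = #{x ∈ Icc 1 n ×ˢ Icc 1 n | x.2 ≤ P.parts.count x.1} := by
  have hcount (j : ℕ) : #{m ∈ Icc 1 n | m ≤ P.parts.count j} = P.parts.count j := by
    have := (Multiset.count_le_card j P.parts).trans (card_parts_le P)
    rw [show {m ∈ Icc 1 n | m ≤ P.parts.count j} = Icc 1 (P.parts.count j) by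
      ext m; simp only [mem_filter, mem_Icc]; omega]
    simp
  rw [card_filter, sum_product, ← Multiset.sum_count_eq_card (s := Icc 1 n) fun a ha =>
    mem_Icc.2 ⟨P.parts_pos ha, Nat.Partition.le_of_mem_parts ha⟩]
  exact sum_congr rfl fun j _ => by rw [← card_filter, hcount]

lemma sum_antidiagonal_sum_divisors {M : Type*} [AddCommMonoid M] (n : ℕ) (f : ℕ → ℕ → M) :
    ∑ x ∈ antidiagonal n, ∑ d ∈ x.1.divisors, f (x.1 / d) d =
      ∑ x ∈ Icc 1 n ×ˢ Icc 1 n with x.1 * x.2 ≤ n, f x.1 x.2 := by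
  rw [sum_sigma']
  refine sum_bij' (fun y _ => (y.1.1 / y.2, y.2)) (fun x _ => ⟨(x.1 * x.2, n - x.1 * x.2), x.2⟩)
    ?_ ?_ ?_ ?_ fun _ _ => rfl
  · rintro ⟨⟨a, b⟩, d⟩ hy
    simp only [mem_sigma, HasAntidiagonal.mem_antidiagonal, Nat.mem_divisors] at hy
    obtain ⟨hab, ⟨e, rfl⟩, hne⟩ := hy
    have hd : 0 < d := Nat.pos_of_ne_zero fun h => hne (by simp [h])
    have he : 0 < e := Nat.pos_of_ne_zero fun h => hne (by simp [h])
    simp only [mem_filter, mem_product, mem_Icc, Nat.mul_div_cancel_left _ hd]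
    have := Nat.le_mul_of_pos_left e hd
    have := Nat.le_mul_of_pos_right d he
    have := mul_comm e d
    omega
  · rintro ⟨j, m⟩ hx
    simp only [mem_filter, mem_product, mem_Icc] at hx
    simp only [mem_sigma, HasAntidiagonal.mem_antidiagonal, Nat.mem_divisors]
    exact ⟨by omega, Dvd.intro_left _ rfl, (Nat.mul_pos (by omega) (by omega)).ne'⟩
  · rintro ⟨⟨a, b⟩, d⟩ hy
    simp only [mem_sigma, HasAntidiagonal.mem_antidiagonal, Nat.mem_divisors] at hy
    obtain rfl : b = n - a := by omega
    simp only [Nat.div_mul_cancel hy.2.1]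
  · rintro ⟨j, m⟩ hx
    simp only [mem_filter, mem_product, mem_Icc] at hx
    simp only [Nat.mul_div_cancel _ (show 0 < m by omega)]

lemma sum_card_parts_mul (n : ℕ) (g : ℕ → ℕ) :
    ∑ P : n.Partition, P.parts.card * g P.parts.card =
      ∑ x ∈ antidiagonal n, ∑ d ∈ x.1.divisors, ∑ P : x.2.Partition, g (P.parts.card + d) := by
  calc ∑ P : n.Partition, P.parts.card * g P.parts.card
      = ∑ P : n.Partition, ∑ x ∈ Icc 1 n ×ˢ Icc 1 n with x.2 ≤ P.parts.count x.1,
          g P.parts.card := sum_congr rfl fun P _ => by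
        rw [sum_const, smul_eq_mul, ← card_parts_eq_card_filter]
    _ = ∑ x ∈ Icc 1 n ×ˢ Icc 1 n, ∑ P : n.Partition with x.2 ≤ P.parts.count x.1,
          g P.parts.card := by simp_rw [sum_filter]; exact sum_comm
    _ = ∑ x ∈ Icc 1 n ×ˢ Icc 1 n with x.1 * x.2 ≤ n,
          ∑ P : n.Partition with x.2 ≤ P.parts.count x.1, g P.parts.card := by
        refine (sum_filter_of_ne fun x _ hne => ?_).symm
        obtain ⟨P, hP, _⟩ := exists_ne_zero_of_sum_ne_zero hne
        have := mul_add_sum_sub_replicate (mem_filter.1 hP).2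
        omega
    _ = ∑ x ∈ antidiagonal n, ∑ d ∈ x.1.divisors,
          ∑ P : n.Partition with d ≤ P.parts.count (x.1 / d), g P.parts.card :=
        by rw [← sum_antidiagonal_sum_divisors n fun j m =>
          ∑ P : n.Partition with m ≤ P.parts.count j, g P.parts.card]
    _ = _ := sum_congr rfl fun x hx => sum_congr rfl fun d hd => by
        obtain ⟨hdvd, hne⟩ := Nat.mem_divisors.1 hd
        rw [sum_partition_count_ge (r := x.2) ?_ ?_ fun s => g s.card]
        · simp only [Multiset.card_add, Multiset.card_replicate]
        · exact Nat.div_pos (Nat.le_of_dvd (Nat.pos_of_ne_zero hne) hdvd)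
            (Nat.pos_of_mem_divisors hd)
        · rw [Nat.div_mul_cancel hdvd, HasAntidiagonal.mem_antidiagonal.1 hx]

lemma moment_succ (k n : ℕ) :
    moment (k + 1) n = ∑ x ∈ antidiagonal n, ∑ i ∈ range (k + 1),
      k.choose i * (ArithmeticFunction.sigma i x.1 * moment (k - i) x.2) := by
  have hbinom (x : ℕ × ℕ) (d : ℕ) (P : x.2.Partition) : (P.parts.card + d) ^ k =
      ∑ i ∈ range (k + 1), k.choose i * (d ^ i * P.parts.card ^ (k - i)) := by
    rw [add_comm, add_pow]
    exact sum_congr rfl fun i _ => by rw [Nat.cast_id]; ring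
  rw [moment_eq_sum_partition]
  simp_rw [pow_succ']
  rw [sum_card_parts_mul n (· ^ k)]
  refine sum_congr rfl fun x _ => ?_
  simp_rw [hbinom, moment_eq_sum_partition, ArithmeticFunction.sigma_apply, sum_mul_sum, mul_sum]
  rw [sum_comm (s := range (k + 1))]
  exact sum_congr rfl fun d _ => sum_comm

end PartsRecurrence

section CompleteBellPolynomial

open Finset

/-- The complete Bell polynomial `B_k(x_1, …, x_k)`, defined by its binomial recurrence; the
variable `x_{i+1}` is `x i`. -/
def completeBell {R : Type*} [CommSemiring R] (x : ℕ → R) : ℕ → R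
  | 0 => 1
  | k + 1 => ∑ i : Fin (k + 1), k.choose i * (x i * completeBell x (k - i))
decreasing_by omega

section CommSemiring

variable {R : Type*} [CommSemiring R]

@[simp]
lemma completeBell_zero (x : ℕ → R) : completeBell x 0 = 1 := by
  rw [completeBell]

lemma completeBell_succ (x : ℕ → R) (k : ℕ) :
    completeBell x (k + 1) =
      ∑ i ∈ range (k + 1), k.choose i * (x i * completeBell x (k - i)) := by
  rw [completeBell, sum_range]

lemma eq_completeBell_mul (x y : ℕ → R)
    (h : ∀ k, y (k + 1) = ∑ i ∈ range (k + 1), k.choose i * (x i * y (k - i))) (k : ℕ) :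
    y k = completeBell x k * y 0 := by
  induction k using Nat.strong_induction_on with
  | _ k ih =>
    cases k with
    | zero => simp
    | succ k =>
      rw [h, completeBell_succ, sum_mul]
      refine sum_congr rfl fun i _ => ?_
      rw [ih (k - i) (by omega)]
      ring

lemma completeBell_pow_mul (c : R) (x : ℕ → R) (k : ℕ) :
    completeBell (fun i => c ^ (i + 1) * x i) k = c ^ k * completeBell x k := by
  induction k using Nat.strong_induction_on with
  | _ k ih =>
    cases k with
    | zero => simp
    | succ k =>
      rw [completeBell_succ, completeBell_succ, mul_sum]
      refine sum_congr rfl fun i hi => ?_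
      have hpow : c ^ (k + 1) = c ^ (i + 1) * c ^ (k - i) := by
        rw [← pow_add]; congr 1; have := mem_range.1 hi; omega
      rw [ih (k - i) (by omega), hpow]
      ring

end CommSemiring

lemma map_completeBell {R S : Type*} [CommSemiring R] [CommSemiring S] (φ : R →+* S) (x : ℕ → R)
    (k : ℕ) : φ (completeBell x k) = completeBell (fun i => φ (x i)) k := by
  have h := eq_completeBell_mul (fun i => φ (x i)) (fun k => φ (completeBell x k))
    (fun k => by simp [completeBell_succ]) k
  simpa using h

lemma completeBell_pos {R : Type*} [CommSemiring R] [PartialOrder R] [IsStrictOrderedRing R]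
    {x : ℕ → R} (hx : ∀ i, 0 < x i) (k : ℕ) : 0 < completeBell x k := by
  induction k using Nat.strong_induction_on with
  | _ k ih =>
    cases k with
    | zero => simp
    | succ k =>
      rw [completeBell_succ]
      refine sum_pos (fun i hi => ?_) ⟨0, by simp⟩
      have hchoose : (0 : R) < k.choose i :=
        Nat.cast_pos.2 (Nat.choose_pos (mem_range_succ_iff.1 hi))
      exact mul_pos hchoose (mul_pos (hx i) (ih (k - i) (by omega)))

/-- The product of `(x_j / j!) ^ b_j / b_j!` over the parts `j` of `s`, where `b_j` is the
multiplicity of `j`; the argument `x_j` is `x (j - 1)`. -/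
noncomputable def bellWeight (x : ℕ → ℝ) (s : Multiset ℕ) : ℝ :=
  ∏ j ∈ s.toFinset, (x (j - 1) / j.factorial) ^ s.count j / (s.count j).factorial

lemma bellWeight_eq_prod (x : ℕ → ℝ) {s : Multiset ℕ} {t : Finset ℕ} (h : s.toFinset ⊆ t) :
    bellWeight x s =
      ∏ j ∈ t, (x (j - 1) / j.factorial) ^ s.count j / (s.count j).factorial := by
  refine prod_subset h fun j _ hj => ?_
  rw [Multiset.mem_toFinset, ← Multiset.count_eq_zero] at hj
  simp [hj]

lemma succ_count_mul_bellWeight_cons (x : ℕ → ℝ) (s : Multiset ℕ) (j : ℕ) :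
    (s.count j + 1) * bellWeight x (j ::ₘ s) = x (j - 1) / j.factorial * bellWeight x s := by
  have hj : j ∈ (j ::ₘ s).toFinset := by simp
  rw [bellWeight_eq_prod x (Multiset.toFinset_subset.2 (Multiset.subset_cons s j)), bellWeight,
    ← mul_prod_erase _ _ hj, ← mul_prod_erase _ _ hj,
    prod_congr rfl fun i hi => by rw [Multiset.count_cons_of_ne (ne_of_mem_erase hi)],
    Multiset.count_cons_self, Nat.factorial_succ, pow_succ]
  push_cast
  field_simp

lemma sum_count_mul_bellWeight (x : ℕ → ℝ) {i r n : ℕ} (h : i + 1 + r = n) :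
    ∑ P : n.Partition, P.parts.count (i + 1) * bellWeight x P.parts =
      x i / (i + 1).factorial * ∑ P : r.Partition, bellWeight x P.parts := by
  have hfilter : ∀ P ∈ (univ : Finset n.Partition),
      P.parts.count (i + 1) * bellWeight x P.parts ≠ 0 → 1 ≤ P.parts.count (i + 1) := by
    intro P _ hne
    by_contra hP
    exact hne (by simp [Nat.lt_one_iff.1 (not_le.1 hP)])
  rw [← sum_filter_of_ne hfilter, sum_partition_count_ge i.succ_pos (by rwa [mul_one])
    fun s => s.count (i + 1) * bellWeight x s, mul_sum]
  refine sum_congr rfl fun P _ => ?_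
  rw [Multiset.replicate_one, add_comm P.parts, Multiset.singleton_add, Multiset.count_cons_self,
    Nat.cast_succ, succ_count_mul_bellWeight_cons, Nat.add_sub_cancel]

lemma toFinset_parts_subset {n : ℕ} (P : n.Partition) : P.parts.toFinset ⊆ Ico 1 (n + 1) :=
  fun a ha => by
    rw [Multiset.mem_toFinset] at ha
    exact mem_Ico.2 ⟨P.parts_pos ha, Nat.lt_succ_of_le (Nat.Partition.le_of_mem_parts ha)⟩

lemma sum_succ_mul_count {n : ℕ} (P : n.Partition) :
    ∑ i ∈ range n, (i + 1) * P.parts.count (i + 1) = n := by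
  conv_rhs => rw [← P.parts_sum, sum_multiset_count_of_subset _ _ (toFinset_parts_subset P),
    sum_Ico_eq_sum_range]
  exact sum_congr rfl fun i _ => by rw [smul_eq_mul, mul_comm, add_comm 1]

lemma succ_mul_sum_bellWeight (x : ℕ → ℝ) (k : ℕ) :
    (k + 1) * ∑ P : (k + 1).Partition, bellWeight x P.parts =
      ∑ i ∈ range (k + 1), x i / i.factorial * ∑ P : (k - i).Partition, bellWeight x P.parts := by
  have hsum (P : (k + 1).Partition) :
      (k + 1 : ℝ) = ∑ i ∈ range (k + 1), (i + 1 : ℝ) * P.parts.count (i + 1) := by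
    exact_mod_cast (sum_succ_mul_count P).symm
  calc (k + 1) * ∑ P : (k + 1).Partition, bellWeight x P.parts
      = ∑ P : (k + 1).Partition, ∑ i ∈ range (k + 1),
          (i + 1) * (P.parts.count (i + 1) * bellWeight x P.parts) := by
        rw [mul_sum]
        exact sum_congr rfl fun P _ => by rw [hsum P, sum_mul]; simp_rw [mul_assoc]
    _ = ∑ i ∈ range (k + 1), (i + 1) *
          ∑ P : (k + 1).Partition, P.parts.count (i + 1) * bellWeight x P.parts := by
        rw [sum_comm]; simp_rw [mul_sum]
    _ = _ := sum_congr rfl fun i hi => by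
        have := mem_range.1 hi
        rw [sum_count_mul_bellWeight x (r := k - i) (by omega), Nat.factorial_succ]
        push_cast
        field_simp

lemma completeBell_eq_sum_partition (x : ℕ → ℝ) (k : ℕ) :
    completeBell x k = k.factorial * ∑ P : k.Partition, bellWeight x P.parts := by
  rw [eq_completeBell_mul x (fun k => k.factorial * ∑ P : k.Partition, bellWeight x P.parts)]
  · simp [bellWeight]
  · intro k
    rw [Nat.factorial_succ, mul_comm (k + 1), Nat.cast_mul, mul_assoc, Nat.cast_succ,
      succ_mul_sum_bellWeight, mul_sum]
    refine sum_congr rfl fun i hi => ?_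
    rw [Nat.cast_choose ℝ (mem_range_succ_iff.1 hi)]
    field_simp

lemma mem_solutions {k : ℕ} {b : Fin k → ℕ} :
    b ∈ solutions k ↔ ∑ i : Fin k, ((i : ℕ) + 1) * b i = k := by
  simp only [solutions, mem_filter, Fintype.mem_piFinset, mem_range, and_iff_right_iff_imp]
  intro h i
  have hi := single_le_sum (f := fun i : Fin k => ((i : ℕ) + 1) * b i)
    (fun _ _ => Nat.zero_le _) (mem_univ i)
  exact Nat.lt_succ_of_le ((Nat.le_mul_of_pos_left _ (Nat.succ_pos _)).trans (hi.trans_eq h))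

lemma exists_partition_of_mem_solutions {k : ℕ} {b : Fin k → ℕ} (hb : b ∈ solutions k) :
    ∃ P : k.Partition, ∀ i : Fin k, P.parts.count ((i : ℕ) + 1) = b i := by
  refine ⟨⟨∑ i : Fin k, Multiset.replicate (b i) ((i : ℕ) + 1), fun hj => ?_, ?_⟩, fun i => ?_⟩
  · obtain ⟨i, -, hi⟩ := Multiset.mem_sum.1 hj
    exact Multiset.eq_of_mem_replicate hi ▸ Nat.succ_pos _
  · simpa [Multiset.sum_sum, mul_comm] using mem_solutions.1 hb
  · simp [Multiset.count_sum', Multiset.count_replicate, Fin.val_inj]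

lemma partition_ext_count {n : ℕ} {P Q : n.Partition}
    (h : ∀ i < n, P.parts.count (i + 1) = Q.parts.count (i + 1)) : P = Q := by
  have hsub (P : n.Partition) {j : ℕ} (hj : j = 0 ∨ n < j) : P.parts.count j = 0 :=
    Multiset.count_eq_zero.2 fun hmem => by
      have := P.parts_pos hmem
      have := Nat.Partition.le_of_mem_parts hmem
      omega
  refine Nat.Partition.ext (Multiset.ext.2 fun j => ?_)
  by_cases hj : j = 0 ∨ n < j
  · rw [hsub P hj, hsub Q hj]
  · obtain ⟨i, rfl⟩ := Nat.exists_eq_succ_of_ne_zero (show j ≠ 0 by omega)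
    exact h i (by omega)

lemma bellSum_eq_sum_partition (k : ℕ) (x : ℕ → ℝ) :
    bellSum k (fun i => x i) = k.factorial * ∑ P : k.Partition, bellWeight x P.parts := by
  rw [bellSum, mul_sum]
  symm
  refine sum_bij (fun P _ i => P.parts.count ((i : ℕ) + 1)) (fun P _ => ?_)
    (fun P _ Q _ h => partition_ext_count fun i hi => congrFun h ⟨i, hi⟩)
    (fun b hb => ?_) fun P _ => ?_
  · rw [mem_solutions, Fin.sum_univ_eq_sum_range fun i => (i + 1) * P.parts.count (i + 1),
      sum_succ_mul_count]
  · obtain ⟨P, hP⟩ := exists_partition_of_mem_solutions hb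
    exact ⟨P, mem_univ P, funext hP⟩
  · rw [bellWeight_eq_prod x (toFinset_parts_subset P), prod_Ico_eq_prod_range,
      Nat.add_sub_cancel, prod_range, div_mul_eq_mul_div, mul_div_assoc, ← prod_div_distrib]
    simp only [add_comm 1, Nat.add_sub_cancel]

lemma bellSum_eq_completeBell (k : ℕ) (x : ℕ → ℝ) :
    bellSum k (fun i => x i) = completeBell x k := by
  rw [bellSum_eq_sum_partition, completeBell_eq_sum_partition]

end CompleteBellPolynomial

section BellGeneratingFunction

open Finset

section IsBigO

variable {α : Type*} {l : Filter α} {x y : ℕ → α → ℝ}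

lemma isBigO_completeBell_succ_of_mem_range (hx : ∀ᶠ a in l, ∀ i, 0 < x i a) {k i : ℕ}
    (hi : i ∈ range (k + 1)) :
    (fun a => x i a * completeBell (x · a) (k - i)) =O[l]
      fun a => completeBell (x · a) (k + 1) := by
  refine IsBigO.of_bound 1 (hx.mono fun a ha => ?_)
  have hterm (j : ℕ) : 0 ≤ x j a * completeBell (x · a) (k - j) :=
    mul_nonneg (ha j).le (completeBell_pos ha _).le
  rw [one_mul, Real.norm_of_nonneg (hterm i), Real.norm_of_nonneg (completeBell_pos ha _).le,
    completeBell_succ]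
  calc x i a * completeBell (x · a) (k - i)
      ≤ k.choose i * (x i a * completeBell (x · a) (k - i)) :=
        le_mul_of_one_le_left (hterm i)
          (Nat.one_le_cast.2 (Nat.choose_pos (mem_range_succ_iff.1 hi)))
    _ ≤ _ := single_le_sum
        (f := fun j => (k.choose j : ℝ) * (x j a * completeBell (x · a) (k - j)))
        (fun j _ => mul_nonneg (Nat.cast_nonneg _) (hterm j)) hi

lemma isBigO_completeBell (hx : ∀ᶠ a in l, ∀ i, 0 < x i a) (h : ∀ i, y i =O[l] x i) (k : ℕ) :
    (fun a => completeBell (y · a) k) =O[l] fun a => completeBell (x · a) k := by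
  induction k using Nat.strong_induction_on with
  | _ k ih =>
    cases k with
    | zero => simpa using isBigO_refl (fun _ => (1 : ℝ)) l
    | succ k =>
      simp only [completeBell_succ (y · _)]
      exact IsBigO.fun_sum fun i hi => (((h i).mul (ih (k - i) (by omega))).trans
        (isBigO_completeBell_succ_of_mem_range hx hi)).const_mul_left _

lemma isBigO_completeBell_sub {ε : α → ℝ} (hx : ∀ᶠ a in l, ∀ i, 0 < x i a)
    (hε : ε =O[l] fun _ => (1 : ℝ)) (h : ∀ i, (fun a => y i a - x i a) =O[l] fun a => ε a * x i a)
    (k : ℕ) :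
    (fun a => completeBell (y · a) k - completeBell (x · a) k) =O[l]
      fun a => ε a * completeBell (x · a) k := by
  have hy (i : ℕ) : y i =O[l] x i := by
    have hεx : (fun a => ε a * x i a) =O[l] x i := by simpa using hε.mul (isBigO_refl (x i) l)
    simpa using ((h i).trans hεx).add (isBigO_refl (x i) l)
  induction k using Nat.strong_induction_on with
  | _ k ih =>
    cases k with
    | zero => simpa using isBigO_zero _ _
    | succ k =>
      have hterm : ∀ i ∈ range (k + 1),
          (fun a => (y i a - x i a) * completeBell (y · a) (k - i) +
            x i a * (completeBell (y · a) (k - i) - completeBell (x · a) (k - i))) =O[l]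
          fun a => ε a * completeBell (x · a) (k + 1) := fun i hi => by
        have hsub := (h i).mul (isBigO_completeBell hx hy (k - i))
        have hrec := (isBigO_refl (x i) l).mul (ih (k - i) (by omega))
        simp only [mul_assoc, mul_left_comm (x i _)] at hsub hrec
        exact (hsub.add hrec).trans
          ((isBigO_refl ε l).mul (isBigO_completeBell_succ_of_mem_range hx hi))
      refine (IsBigO.fun_sum fun i hi => (hterm i hi).const_mul_left (k.choose i : ℝ)).congr_left
        fun a => ?_
      rw [completeBell_succ, completeBell_succ, ← sum_sub_distrib]
      exact sum_congr rfl fun i _ => by ring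

end IsBigO

open scoped PowerSeries

/-- The power series `∑ σ_i(n) X ^ n`. -/
def sigmaSeries (i : ℕ) : ℕ⟦X⟧ :=
  PowerSeries.mk fun n => ArithmeticFunction.sigma i n

/-- The generating function of the `k`-th moments. -/
def momentSeries (k : ℕ) : ℕ⟦X⟧ :=
  PowerSeries.mk (moment k)

lemma momentSeries_succ (k : ℕ) : momentSeries (k + 1) =
    ∑ i ∈ range (k + 1), (k.choose i : ℕ⟦X⟧) * (sigmaSeries i * momentSeries (k - i)) := by
  ext n
  simp only [momentSeries, sigmaSeries, map_sum, PowerSeries.coeff_mk, moment_succ]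
  rw [sum_comm]
  refine sum_congr rfl fun i _ => ?_
  rw [← map_natCast (PowerSeries.C (R := ℕ)), PowerSeries.coeff_C_mul, PowerSeries.coeff_mul,
    mul_sum]
  simp

lemma momentSeries_eq (k : ℕ) :
    momentSeries k = completeBell sigmaSeries k * momentSeries 0 :=
  eq_completeBell_mul sigmaSeries momentSeries momentSeries_succ k

lemma moment_eq_sum_coeff (k n : ℕ) :
    moment k n = ∑ m ∈ range (n + 1),
      PowerSeries.coeff m (completeBell sigmaSeries k) * Fintype.card (n - m).Partition := by
  have h := congrArg (PowerSeries.coeff n) (momentSeries_eq k)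
  rw [PowerSeries.coeff_mul, Nat.sum_antidiagonal_eq_sum_range_succ_mk] at h
  simpa [momentSeries, moment_zero] using h

section Evaluation

variable {R : Type*} [NormedCommRing R]

/-- The power series `f` converges absolutely at `x`, with sum `v`. -/
def AbsHasSum (f : R⟦X⟧) (x v : R) : Prop :=
  (Summable fun n => ‖PowerSeries.coeff n f * x ^ n‖) ∧
    HasSum (fun n => PowerSeries.coeff n f * x ^ n) v

lemma absHasSum_C (a x : R) : AbsHasSum (PowerSeries.C a) x a := by
  have h : ∀ n, n ≠ 0 → PowerSeries.coeff n (PowerSeries.C a) * x ^ n = 0 := fun n hn => by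
    simp [PowerSeries.coeff_C, hn]
  refine ⟨summable_of_ne_finset_zero (s := {0}) fun n hn => ?_, ?_⟩
  · rw [h n (by simpa using hn), norm_zero]
  · simpa [PowerSeries.coeff_C] using hasSum_single 0 h

lemma absHasSum_one (x : R) : AbsHasSum 1 x 1 := by
  simpa using absHasSum_C 1 x

lemma AbsHasSum.add {f g : R⟦X⟧} {x v w : R} (hf : AbsHasSum f x v) (hg : AbsHasSum g x w) :
    AbsHasSum (f + g) x (v + w) := by
  simp only [AbsHasSum, map_add, add_mul]
  exact ⟨(hf.1.add hg.1).of_nonneg_of_le (fun _ => norm_nonneg _) fun n => norm_add_le _ _,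
    hf.2.add hg.2⟩

lemma AbsHasSum.sum {ι : Type*} {s : Finset ι} {f : ι → R⟦X⟧} {x : R} {v : ι → R}
    (h : ∀ i ∈ s, AbsHasSum (f i) x (v i)) : AbsHasSum (∑ i ∈ s, f i) x (∑ i ∈ s, v i) := by
  classical
  induction s using Finset.induction_on with
  | empty => simpa using absHasSum_C 0 x
  | insert a s ha ih =>
    rw [sum_insert ha, sum_insert ha]
    exact (h a (mem_insert_self a s)).add (ih fun i hi => h i (mem_insert_of_mem hi))

variable [CompleteSpace R]

lemma AbsHasSum.mul {f g : R⟦X⟧} {x v w : R} (hf : AbsHasSum f x v) (hg : AbsHasSum g x w) :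
    AbsHasSum (f * g) x (v * w) := by
  have hcoeff (n : ℕ) : PowerSeries.coeff n (f * g) * x ^ n = ∑ p ∈ antidiagonal n,
      (PowerSeries.coeff p.1 f * x ^ p.1) * (PowerSeries.coeff p.2 g * x ^ p.2) := by
    rw [PowerSeries.coeff_mul, sum_mul]
    refine sum_congr rfl fun p hp => ?_
    rw [← HasAntidiagonal.mem_antidiagonal.1 hp, pow_add]
    ring
  have hsum := summable_norm_sum_mul_antidiagonal_of_summable_norm hf.1 hg.1
  simp only [AbsHasSum, hcoeff]
  rw [← hf.2.tsum_eq, ← hg.2.tsum_eq,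
    tsum_mul_tsum_eq_tsum_sum_antidiagonal_of_summable_norm hf.1 hg.1]
  exact ⟨hsum, hsum.of_norm.hasSum⟩

lemma AbsHasSum.prod {ι : Type*} {s : Finset ι} {f : ι → R⟦X⟧} {x : R} {v : ι → R}
    (h : ∀ i ∈ s, AbsHasSum (f i) x (v i)) : AbsHasSum (∏ i ∈ s, f i) x (∏ i ∈ s, v i) := by
  classical
  induction s using Finset.induction_on with
  | empty => simpa using absHasSum_one x
  | insert a s ha ih =>
    rw [prod_insert ha, prod_insert ha]
    exact (h a (mem_insert_self a s)).mul (ih fun i hi => h i (mem_insert_of_mem hi))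

lemma AbsHasSum.completeBell {f : ℕ → R⟦X⟧} {x : R} {v : ℕ → R}
    (h : ∀ i, AbsHasSum (f i) x (v i)) (k : ℕ) :
    AbsHasSum (completeBell f k) x (completeBell v k) := by
  induction k using Nat.strong_induction_on with
  | _ k ih =>
    cases k with
    | zero => simpa using absHasSum_one x
    | succ k =>
      rw [completeBell_succ, completeBell_succ]
      refine .sum fun i _ => .mul ?_ ((h i).mul (ih (k - i) (by omega)))
      simpa using absHasSum_C (k.choose i : R) x

end Evaluation

end BellGeneratingFunction

section LambertSeries

open MeasureTheory Set
open scoped Topology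

section RiemannSum

variable {E : Type*} [NormedAddCommGroup E] [NormedSpace ℝ E] {g g' : ℝ → E}

lemma norm_sub_smul_sub_integral_le [CompleteSpace E] {a b : ℝ} (hab : a ≤ b)
    (hg : ∀ x ∈ Ioc a b, HasDerivAt g (g' x) x) (hint : IntegrableOn g (Ioc a b))
    (hint' : IntegrableOn g' (Ioc a b)) :
    ‖(b - a) • g b - ∫ x in Ioc a b, g x‖ ≤ (b - a) * ∫ x in Ioc a b, ‖g' x‖ := by
  have hbound : ∀ x ∈ Ioc a b, ‖g b - g x‖ ≤ ∫ y in Ioc a b, ‖g' y‖ := fun x hx => by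
    have hsub : Ioc x b ⊆ Ioc a b := Ioc_subset_Ioc_left hx.1.le
    rw [← intervalIntegral.integral_eq_sub_of_hasDerivAt
      (fun y hy => hg y ⟨hx.1.trans_le ?_, ?_⟩)
      ((intervalIntegrable_iff_integrableOn_Ioc_of_le hx.2).2 (hint'.mono_set hsub)),
      intervalIntegral.integral_of_le hx.2]
    · exact (norm_integral_le_integral_norm _).trans (setIntegral_mono_set hint'.norm
        (ae_of_all _ fun _ => norm_nonneg _) hsub.eventuallyLE)
    · exact (uIcc_of_le hx.2 ▸ hy).1
    · exact (uIcc_of_le hx.2 ▸ hy).2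
  have hsub : ∫ x in Ioc a b, (g b - g x) = (b - a) • g b - ∫ x in Ioc a b, g x := by
    rw [integral_sub (integrable_const _) hint, setIntegral_const, Real.volume_real_Ioc_of_le hab]
  rw [← hsub, mul_comm]
  simpa [Real.volume_real_Ioc_of_le hab] using
    norm_setIntegral_le_of_norm_le_const (measure_Ioc_lt_top (μ := volume)) hbound

lemma iUnion_Ioc_nat_mul {s : ℝ} (hs : 0 < s) :
    ⋃ m : ℕ, Ioc (m * s) ((m + 1 : ℕ) * s) = Ioi 0 := by
  refine subset_antisymm (iUnion_subset fun m x hx => ?_) fun x hx => ?_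
  · exact (by positivity : (0 : ℝ) ≤ m * s).trans_lt hx.1
  · obtain ⟨m, hm⟩ := Nat.exists_eq_add_one.2 (Nat.ceil_pos.2 (div_pos hx hs))
    refine mem_iUnion.2 ⟨m, ?_, ?_⟩
    · rw [← lt_div_iff₀ hs, ← Nat.lt_ceil]
      omega
    · rw [← div_le_iff₀ hs, ← Nat.ceil_le]
      omega

lemma hasSum_setIntegral_Ioc_nat_mul {s : ℝ} (hs : 0 < s) (hint : IntegrableOn g (Ioi 0)) :
    HasSum (fun m : ℕ => ∫ x in Ioc (m * s) ((m + 1 : ℕ) * s), g x) (∫ x in Ioi 0, g x) := by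
  rw [← iUnion_Ioc_nat_mul hs] at hint ⊢
  have hmono : Monotone fun m : ℕ => (m : ℝ) * s := Nat.mono_cast.mul_const hs.le
  exact hasSum_integral_iUnion (fun m => measurableSet_Ioc) hmono.pairwise_disjoint_on_Ioc_succ hint

lemma summable_and_norm_smul_tsum_sub_integral_le [CompleteSpace E] {s : ℝ} (hs : 0 < s)
    (hg : ∀ x ∈ Ioi (0 : ℝ), HasDerivAt g (g' x) x) (hint : IntegrableOn g (Ioi 0))
    (hint' : IntegrableOn g' (Ioi 0)) :
    (Summable fun m : ℕ => g ((m + 1 : ℕ) * s)) ∧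
      ‖s • ∑' m : ℕ, g ((m + 1 : ℕ) * s) - ∫ x in Ioi 0, g x‖ ≤ s * ∫ x in Ioi 0, ‖g' x‖ := by
  have hsubset (m : ℕ) : Ioc (m * s) ((m + 1 : ℕ) * s) ⊆ Ioi 0 :=
    (subset_iUnion_of_subset m subset_rfl).trans (iUnion_Ioc_nat_mul hs).subset
  have hterm (m : ℕ) : ‖s • g ((m + 1 : ℕ) * s) - ∫ x in Ioc (m * s) ((m + 1 : ℕ) * s), g x‖ ≤
      s * ∫ x in Ioc (m * s) ((m + 1 : ℕ) * s), ‖g' x‖ := by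
    have h := norm_sub_smul_sub_integral_le (a := m * s) (b := (m + 1 : ℕ) * s) (by gcongr; simp)
      (fun x hx => hg x (hsubset m hx)) (hint.mono_set (hsubset m)) (hint'.mono_set (hsubset m))
    rwa [← sub_mul, Nat.cast_add_one, add_sub_cancel_left, one_mul, ← Nat.cast_add_one] at h
  have hbound := (hasSum_setIntegral_Ioc_nat_mul hs hint'.norm).mul_left s
  have hint_sum := hasSum_setIntegral_Ioc_nat_mul hs hint
  have hsummable : Summable fun m : ℕ => g ((m + 1 : ℕ) * s) := by
    have hdiff := Summable.of_norm_bounded hbound.summable hterm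
    simpa [inv_smul_smul₀ hs.ne'] using (hdiff.add hint_sum.summable).const_smul s⁻¹
  exact ⟨hsummable, HasSum.norm_le_of_bounded
    ((hsummable.hasSum.const_smul s).sub hint_sum) hbound hterm⟩

lemma isBigO_smul_tsum_sub_integral [CompleteSpace E]
    (hg : ∀ x ∈ Ioi (0 : ℝ), HasDerivAt g (g' x) x) (hint : IntegrableOn g (Ioi 0))
    (hint' : IntegrableOn g' (Ioi 0)) :
    (fun s : ℝ => s • ∑' m : ℕ, g ((m + 1 : ℕ) * s) - ∫ x in Ioi 0, g x) =O[𝓝[>] 0] fun s => s := by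
  refine IsBigO.of_bound (∫ x in Ioi 0, ‖g' x‖)
    (eventually_nhdsWithin_of_forall fun s (hs : 0 < s) => ?_)
  rw [Real.norm_of_nonneg hs.le, mul_comm]
  exact (summable_and_norm_smul_tsum_sub_integral_le hs hg hint hint').2

end RiemannSum

/-- The Lambert series `∑ σ_i(n) e ^ (-n t)`. -/
noncomputable def lambert (i : ℕ) (t : ℝ) : ℝ :=
  ∑' n : ℕ, (ArithmeticFunction.sigma i n : ℝ) * Real.exp (-t) ^ n

lemma norm_exp_neg_lt_one {t : ℝ} (ht : 0 < t) : ‖Real.exp (-t)‖ < 1 := by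
  simpa using ht

lemma exp_sub_one_pos {t : ℝ} (ht : 0 < t) : 0 < Real.exp t - 1 :=
  sub_pos.2 (Real.one_lt_exp_iff.2 ht)

lemma summable_sigma_mul_exp_neg_pow (i : ℕ) {t : ℝ} (ht : 0 < t) :
    Summable fun n : ℕ => (ArithmeticFunction.sigma i n : ℝ) * Real.exp (-t) ^ n := by
  refine (summable_pow_mul_geometric_of_norm_lt_one (i + 1)
    (norm_exp_neg_lt_one ht)).of_nonneg_of_le (fun n => by positivity) fun n => ?_
  gcongr
  exact_mod_cast ArithmeticFunction.sigma_le_pow_succ i n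

lemma lambert_eq_tsum (i : ℕ) {t : ℝ} (ht : 0 < t) :
    lambert i t = ∑' m : ℕ, ((m + 1 : ℕ) : ℝ) ^ i / (Real.exp ((m + 1 : ℕ) * t) - 1) := by
  have hpnat := tsum_zero_pnat_eq_tsum_nat (summable_sigma_mul_exp_neg_pow i ht)
  rw [ArithmeticFunction.map_zero, Nat.cast_zero, zero_mul, zero_add] at hpnat
  rw [lambert, ← hpnat, ← tsum_pow_div_one_sub_eq_tsum_sigma (norm_exp_neg_lt_one ht) i,
    tsum_pnat_eq_tsum_succ
      (f := fun n : ℕ => (n : ℝ) ^ i * Real.exp (-t) ^ n / (1 - Real.exp (-t) ^ n))]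
  refine tsum_congr fun m => ?_
  have hm : 0 < ((m + 1 : ℕ) : ℝ) * t := by positivity
  have hpos := exp_sub_one_pos hm
  rw [← Real.exp_nat_mul, mul_neg, Real.exp_neg]
  field_simp

lemma integrableOn_pow_mul_exp_neg_mul (i : ℕ) {b : ℝ} (hb : 0 < b) :
    IntegrableOn (fun x : ℝ => x ^ i * Real.exp (-b * x)) (Ioi 0) := by
  have hi : (-1 : ℝ) < i := neg_one_lt_zero.trans_le i.cast_nonneg
  simpa using integrableOn_rpow_mul_exp_neg_mul_rpow hi one_pos hb

lemma integral_pow_mul_exp_neg_mul (i : ℕ) {b : ℝ} (hb : 0 < b) :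
    ∫ x : ℝ in Ioi 0, x ^ i * Real.exp (-b * x) = i.factorial / b ^ (i + 1) := by
  have h := Real.integral_rpow_mul_exp_neg_mul_Ioi (a := i + 1) (by positivity) hb
  rw [add_sub_cancel_right, Real.Gamma_nat_eq_factorial, ← Nat.cast_add_one] at h
  simp only [Real.rpow_natCast] at h
  rw [div_eq_inv_mul, ← inv_pow, ← one_div, ← h]
  simp only [neg_mul]

section ZetaValues

lemma hasSum_exp_neg_mul {x : ℝ} (hx : 0 < x) :
    HasSum (fun m : ℕ => Real.exp (-(m + 1 : ℕ) * x)) (Real.exp x - 1)⁻¹ := by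
  have h := (hasSum_geometric_of_norm_lt_one (norm_exp_neg_lt_one hx)).mul_left (Real.exp (-x))
  have hpos := exp_sub_one_pos hx
  convert! h using 1
  · funext m
    rw [← Real.exp_nat_mul, ← Real.exp_add]
    push_cast
    ring_nf
  · rw [Real.exp_neg]
    field_simp

lemma div_exp_sub_one_le {x : ℝ} (hx : 0 < x) : x / (Real.exp x - 1) ≤ Real.exp (-(1 / 2) * x) := by
  have hsinh := Real.self_le_sinh_iff.2 (half_pos hx).le
  rw [Real.sinh_eq] at hsinh
  rw [div_le_iff₀ (exp_sub_one_pos hx), mul_sub, ← Real.exp_add, mul_one]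
  ring_nf at hsinh ⊢
  linarith

lemma hasDerivAt_div_exp_sub_one {x : ℝ} (hx : 0 < x) :
    HasDerivAt (fun x => x / (Real.exp x - 1))
      ((Real.exp x - 1 - x * Real.exp x) / (Real.exp x - 1) ^ 2) x := by
  simpa using (hasDerivAt_id x).fun_div ((Real.hasDerivAt_exp x).sub_const 1)
    (exp_sub_one_pos hx).ne'

lemma abs_deriv_div_exp_sub_one_le {x : ℝ} (hx : 0 < x) :
    |(Real.exp x - 1 - x * Real.exp x) / (Real.exp x - 1) ^ 2| ≤ x / (Real.exp x - 1) := by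
  have hpos := exp_sub_one_pos hx
  have hle : (1 - x) * Real.exp x ≤ 1 := by
    have := Real.one_sub_le_exp_neg x
    rwa [Real.exp_neg, ← one_div, le_div_iff₀ (Real.exp_pos x)] at this
  rw [abs_div, abs_of_pos (pow_pos hpos 2), div_le_div_iff₀ (pow_pos hpos 2) hpos, pow_two,
    ← mul_assoc]
  gcongr
  rw [abs_le]
  constructor <;> linarith [Real.add_one_le_exp x]

lemma integrableOn_pow_mul_div_exp_sub_one (i : ℕ) :
    IntegrableOn (fun x : ℝ => x ^ i * (x / (Real.exp x - 1))) (Ioi 0) := by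
  refine (integrableOn_pow_mul_exp_neg_mul i one_half_pos).mono' (by fun_prop) ?_
  refine (ae_restrict_iff' measurableSet_Ioi).2 (ae_of_all _ fun x (hx : 0 < x) => ?_)
  have hpos := exp_sub_one_pos hx
  rw [Real.norm_of_nonneg (by positivity)]
  gcongr
  exact div_exp_sub_one_le hx

lemma integral_pow_mul_div_exp_sub_one (i : ℕ) :
    ∫ x : ℝ in Ioi 0, x ^ i * (x / (Real.exp x - 1)) =
      (i + 1).factorial * (riemannZeta ((i + 2 : ℕ) : ℂ)).re := by
  have hpos (m : ℕ) : (0 : ℝ) < (m + 1 : ℕ) := by positivity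
  have hnorm (m : ℕ) : ∫ x : ℝ in Ioi 0, ‖x ^ (i + 1) * Real.exp (-(m + 1 : ℕ) * x)‖ =
      (i + 1).factorial / ((m + 1 : ℕ) : ℝ) ^ (i + 2) := by
    rw [← integral_pow_mul_exp_neg_mul (i + 1) (hpos m)]
    exact setIntegral_congr_fun measurableSet_Ioi fun x (hx : 0 < x) =>
      Real.norm_of_nonneg (by positivity)
  have hzeta : HasSum (fun m : ℕ => ((i + 1).factorial : ℝ) / ((m + 1 : ℕ) : ℝ) ^ (i + 2))
      ((i + 1).factorial * (riemannZeta ((i + 2 : ℕ) : ℂ)).re) := by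
    have hsum := Real.summable_one_div_nat_pow.2 (show 1 < i + 2 by omega)
    have h := (hasSum_nat_add_iff' 1).2 hsum.hasSum
    have hre : (riemannZeta ((i + 2 : ℕ) : ℂ)).re = ∑' n : ℕ, 1 / (n : ℝ) ^ (i + 2) := by
      rw [zeta_nat_eq_tsum_of_gt_one (by omega), ← Complex.ofReal_re (∑' n : ℕ, 1 / (n : ℝ) ^ _)]
      push_cast
      rfl
    rw [hre]
    simpa [div_eq_mul_inv] using h.mul_left ((i + 1).factorial : ℝ)
  have h := hasSum_integral_of_summable_integral_norm
    (fun m => integrableOn_pow_mul_exp_neg_mul (i + 1) (hpos m))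
    (by simpa only [hnorm] using hzeta.summable)
  simp only [integral_pow_mul_exp_neg_mul _ (hpos _)] at h
  rw [← h.unique hzeta]
  refine setIntegral_congr_fun measurableSet_Ioi fun x (hx : 0 < x) => ?_
  rw [tsum_mul_left, (hasSum_exp_neg_mul hx).tsum_eq]
  ring

lemma integrableOn_deriv_pow_mul_div_exp_sub_one (i : ℕ) :
    IntegrableOn (fun x : ℝ => i * x ^ (i - 1) * (x / (Real.exp x - 1)) +
      x ^ i * ((Real.exp x - 1 - x * Real.exp x) / (Real.exp x - 1) ^ 2)) (Ioi 0) := by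
  simp only [mul_assoc]
  refine ((integrableOn_pow_mul_div_exp_sub_one (i - 1)).const_mul (i : ℝ)).add
    ((integrableOn_pow_mul_div_exp_sub_one i).mono' (by fun_prop) ?_)
  refine (ae_restrict_iff' measurableSet_Ioi).2 (ae_of_all _ fun x (hx : 0 < x) => ?_)
  rw [norm_mul, Real.norm_of_nonneg (pow_nonneg hx.le i)]
  gcongr
  exact abs_deriv_div_exp_sub_one_le hx

lemma isBigO_lambert_succ (i : ℕ) :
    (fun t => t ^ (i + 2) * lambert (i + 1) t -
      (i + 1).factorial * (riemannZeta ((i + 2 : ℕ) : ℂ)).re) =O[𝓝[>] 0] fun t => t := by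
  refine (isBigO_smul_tsum_sub_integral
    (fun x (hx : 0 < x) => (hasDerivAt_pow i x).mul (hasDerivAt_div_exp_sub_one hx))
    (integrableOn_pow_mul_div_exp_sub_one i)
    (integrableOn_deriv_pow_mul_div_exp_sub_one i)).congr'
    (eventually_nhdsWithin_of_forall fun t (ht : 0 < t) => ?_) EventuallyEq.rfl
  simp only [Pi.mul_apply, integral_pow_mul_div_exp_sub_one]
  simp only [lambert_eq_tsum _ ht, smul_eq_mul, ← tsum_mul_left]
  congr! 3 with m
  ring

end ZetaValues

section EulerMascheroni

lemma one_half_add_inv_le_inv_exp_sub_one_add_one {x : ℝ} (hx : 0 < x) :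
    1 / 2 + x⁻¹ ≤ (Real.exp x - 1)⁻¹ + 1 := by
  have hpos := exp_sub_one_pos hx
  have hlog := Real.le_log_one_add_of_nonneg hpos.le
  rw [add_sub_cancel, Real.log_exp, div_le_iff₀ (by linarith)] at hlog
  field_simp
  linarith

lemma inv_exp_sub_one_le_inv {x : ℝ} (hx : 0 < x) : (Real.exp x - 1)⁻¹ ≤ x⁻¹ := by
  gcongr
  linarith [Real.add_one_le_exp x]

lemma inv_exp_sub_one_add_one_le {x : ℝ} (hx : 0 < x) :
    (Real.exp x - 1)⁻¹ + 1 ≤ (1 + x) / 2 + x⁻¹ := by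
  have hquad : x + x ^ 2 / 2 ≤ Real.exp x - 1 := by
    linarith [Real.quadratic_le_exp_of_nonneg hx.le]
  calc (Real.exp x - 1)⁻¹ + 1 ≤ (x + x ^ 2 / 2)⁻¹ + 1 := by gcongr
    _ ≤ (1 + x) / 2 + x⁻¹ := by
      field_simp
      nlinarith [pow_pos hx 2, pow_pos hx 3]

/-- The function `1 / (e ^ x - 1)` made integrable at the origin by the subtraction of
`e ^ (-x) / x`; the latter is summed in closed form over an arithmetic progression. -/
noncomputable def regularizedBose (x : ℝ) : ℝ :=
  (Real.exp x - 1)⁻¹ - Real.exp (-x) / x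

/-- The derivative of `regularizedBose` on the positive half-line. -/
noncomputable def regularizedBoseDeriv (x : ℝ) : ℝ :=
  -Real.exp x / (Real.exp x - 1) ^ 2 + Real.exp (-x) * (x⁻¹ + (x ^ 2)⁻¹)

lemma regularizedBose_eq {x : ℝ} (hx : 0 < x) :
    regularizedBose x = Real.exp (-x) * ((Real.exp x - 1)⁻¹ + 1 - x⁻¹) := by
  have hpos := exp_sub_one_pos hx
  rw [regularizedBose, Real.exp_neg]
  field_simp
  ring

lemma abs_regularizedBose_le {x : ℝ} (hx : 0 < x) : |regularizedBose x| ≤ Real.exp (-x) := by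
  have hlow := one_half_add_inv_le_inv_exp_sub_one_add_one hx
  have hup := inv_exp_sub_one_le_inv hx
  rw [regularizedBose_eq hx, abs_mul, Real.abs_exp]
  exact mul_le_of_le_one_right (Real.exp_nonneg _) (abs_le.2 ⟨by linarith, by linarith⟩)

lemma hasDerivAt_regularizedBose {x : ℝ} (hx : 0 < x) :
    HasDerivAt regularizedBose (regularizedBoseDeriv x) x := by
  refine (((Real.hasDerivAt_exp x).sub_const 1).fun_inv (exp_sub_one_pos hx).ne' |>.sub
    ((hasDerivAt_neg x).exp.fun_div (hasDerivAt_id x) hx.ne')).congr_deriv ?_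
  simp only [regularizedBoseDeriv, id_eq]
  field_simp
  ring

lemma abs_regularizedBoseDeriv_le {x : ℝ} (hx : 0 < x) :
    |regularizedBoseDeriv x| ≤ 2 * Real.exp (-x) := by
  obtain ⟨r, hr⟩ : ∃ r, (Real.exp x - 1)⁻¹ + 1 = r + x⁻¹ := ⟨_, (sub_add_cancel _ _).symm⟩
  have hlow : 1 / 2 ≤ r := by linarith [one_half_add_inv_le_inv_exp_sub_one_add_one hx]
  have hone : r ≤ 1 := by linarith [inv_exp_sub_one_le_inv hx]
  have hup : 2 * r - 1 ≤ x := by linarith [inv_exp_sub_one_add_one_le hx]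
  have hderiv : regularizedBoseDeriv x = -(Real.exp (-x) * (r ^ 2 + (2 * r - 1) / x)) := by
    have hr' : r = (Real.exp x - 1)⁻¹ + 1 - x⁻¹ := eq_sub_of_add_eq hr.symm
    have hpos := exp_sub_one_pos hx
    rw [regularizedBoseDeriv, hr', Real.exp_neg]
    field_simp
    ring
  have hquot : (2 * r - 1) / x ≤ 1 := (div_le_one hx).2 hup
  have hquot' : 0 ≤ (2 * r - 1) / x := div_nonneg (by linarith) hx.le
  rw [hderiv, abs_neg, abs_of_nonneg (by positivity), mul_comm]
  gcongr
  nlinarith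

lemma integrableOn_of_abs_le_mul_exp_neg {f : ℝ → ℝ} {c : ℝ} (hf : Measurable f)
    (h : ∀ x ∈ Ioi (0 : ℝ), |f x| ≤ c * Real.exp (-x)) : IntegrableOn f (Ioi 0) := by
  have hexp := (integrableOn_pow_mul_exp_neg_mul 0 one_pos).const_mul c
  simp only [pow_zero, one_mul, neg_mul] at hexp
  exact hexp.mono' hf.aestronglyMeasurable
    ((ae_restrict_iff' measurableSet_Ioi).2 (ae_of_all _ h))

lemma integrableOn_regularizedBose : IntegrableOn regularizedBose (Ioi 0) :=
  integrableOn_of_abs_le_mul_exp_neg (c := 1) (by unfold regularizedBose; fun_prop)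
    fun _ hx => (abs_regularizedBose_le hx).trans_eq (one_mul _).symm

lemma integrableOn_regularizedBoseDeriv : IntegrableOn regularizedBoseDeriv (Ioi 0) :=
  integrableOn_of_abs_le_mul_exp_neg (by unfold regularizedBoseDeriv; fun_prop)
    fun _ hx => abs_regularizedBoseDeriv_le hx

lemma one_sub_exp_neg_pos {x : ℝ} (hx : 0 < x) : 0 < 1 - Real.exp (-x) := by
  simpa using hx

lemma abs_log_one_sub_exp_neg_sub_log_le {x : ℝ} (hx : 0 < x) :
    |Real.log (1 - Real.exp (-x)) - Real.log x| ≤ x := by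
  have hup := Real.log_le_log (one_sub_exp_neg_pos hx) (by linarith [Real.one_sub_le_exp_neg x])
  have hlow : Real.log (x * Real.exp (-x)) ≤ Real.log (1 - Real.exp (-x)) := by
    refine Real.log_le_log (by positivity) ?_
    have := mul_le_mul_of_nonneg_right (Real.add_one_le_exp x) (Real.exp_nonneg (-x))
    rw [← Real.exp_add, add_neg_cancel, Real.exp_zero] at this
    linarith
  rw [Real.log_mul hx.ne' (Real.exp_ne_zero _), Real.log_exp] at hlow
  exact abs_le.2 ⟨by linarith, by linarith⟩

lemma integral_log_mul_exp_neg :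
    ∫ x in Ioi 0, Real.log x * Real.exp (-x) = -Real.eulerMascheroniConstant := by
  have hre : ∀ᶠ s : ℂ in 𝓝 1, 0 < s.re :=
    (Complex.continuous_re.tendsto 1).eventually_const_lt (by simp)
  have h := ((Complex.hasDerivAt_GammaIntegral (s := 1) (by simp)).congr_of_eventuallyEq
    (hre.mono fun s hs => Complex.Gamma_eq_integral hs)).unique Complex.hasDerivAt_Gamma_one
  simp only [sub_self, Complex.cpow_zero, one_mul] at h
  rw [← Complex.ofReal_inj, ← integral_complex_ofReal]
  simpa using h

lemma integrableOn_log_mul_exp_neg :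
    IntegrableOn (fun x => Real.log x * Real.exp (-x)) (Ioi 0) := by
  refine Integrable.of_integral_ne_zero ?_
  rw [integral_log_mul_exp_neg]
  linarith [Real.one_half_lt_eulerMascheroniConstant]

lemma continuousWithinAt_log_one_sub_exp_neg_sub :
    ContinuousWithinAt (fun x => Real.log (1 - Real.exp (-x)) - Real.log x * Real.exp (-x))
      (Ici 0) 0 := by
  rw [← continuousWithinAt_Ioi_iff_Ici, ContinuousWithinAt]
  have hlog : Tendsto (fun x => |x * Real.log x|) (𝓝[>] 0) (𝓝 0) := by
    simpa using (Real.continuous_mul_log.abs.tendsto 0).mono_left nhdsWithin_le_nhds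
  have hid : Tendsto (fun x : ℝ => x) (𝓝[>] 0) (𝓝 0) := nhdsWithin_le_nhds
  have hbound := hid.add hlog
  rw [add_zero] at hbound
  simp only [neg_zero, Real.exp_zero, sub_self, Real.log_zero, zero_mul]
  refine squeeze_zero_norm' (eventually_nhdsWithin_of_forall fun x (hx : 0 < x) => ?_) hbound
  have hsplit : Real.log (1 - Real.exp (-x)) - Real.log x * Real.exp (-x) =
      (Real.log (1 - Real.exp (-x)) - Real.log x) + (1 - Real.exp (-x)) * Real.log x := by ring
  rw [hsplit, Real.norm_eq_abs]
  refine (abs_add_le _ _).trans (add_le_add (abs_log_one_sub_exp_neg_sub_log_le hx) ?_)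
  rw [abs_mul, abs_mul, abs_of_pos (one_sub_exp_neg_pos hx), abs_of_pos hx]
  gcongr
  linarith [Real.one_sub_le_exp_neg x]

lemma tendsto_log_one_sub_exp_neg_sub_atTop :
    Tendsto (fun x => Real.log (1 - Real.exp (-x)) - Real.log x * Real.exp (-x)) atTop (𝓝 0) := by
  have hfst : Tendsto (fun x => Real.log (1 - Real.exp (-x))) atTop (𝓝 0) := by
    have h := (Real.tendsto_exp_neg_atTop_nhds_zero.const_sub 1).log (by simp)
    simpa using h
  have hsnd : Tendsto (fun x => Real.log x * Real.exp (-x)) atTop (𝓝 0) := by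
    have h := Real.tendsto_pow_mul_exp_neg_atTop_nhds_zero 1
    simp only [pow_one] at h
    refine squeeze_zero' ?_ ?_ h
    · filter_upwards [eventually_ge_atTop 1] with x hx
      exact mul_nonneg (Real.log_nonneg hx) (Real.exp_nonneg _)
    · filter_upwards [eventually_ge_atTop 0] with x hx
      gcongr
      exact Real.log_le_self hx
  simpa using hfst.sub hsnd

lemma integral_regularizedBose :
    ∫ x in Ioi 0, regularizedBose x = Real.eulerMascheroniConstant := by
  have hderiv : ∀ x ∈ Ioi (0 : ℝ), HasDerivAt
      (fun x => Real.log (1 - Real.exp (-x)) - Real.log x * Real.exp (-x))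
      (regularizedBose x + Real.log x * Real.exp (-x)) x := fun x hx => by
    refine (((hasDerivAt_neg x).exp.const_sub 1).log (one_sub_exp_neg_pos hx).ne' |>.sub
      ((Real.hasDerivAt_log (ne_of_gt hx)).mul (hasDerivAt_neg x).exp)).congr_deriv ?_
    have hpos := exp_sub_one_pos hx
    have hne := (one_sub_exp_neg_pos hx).ne'
    rw [regularizedBose, Real.exp_neg] at *
    field_simp
    ring
  have h := integral_Ioi_of_hasDerivAt_of_tendsto continuousWithinAt_log_one_sub_exp_neg_sub hderiv
    (integrableOn_regularizedBose.add integrableOn_log_mul_exp_neg)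
    tendsto_log_one_sub_exp_neg_sub_atTop
  rw [integral_add integrableOn_regularizedBose integrableOn_log_mul_exp_neg,
    integral_log_mul_exp_neg] at h
  simpa [add_neg_eq_zero] using h

lemma mul_tsum_regularizedBose {t : ℝ} (ht : 0 < t) :
    t * ∑' m : ℕ, regularizedBose ((m + 1 : ℕ) * t) =
      t * lambert 0 t + Real.log (1 - Real.exp (-t)) := by
  have hbose := (summable_and_norm_smul_tsum_sub_integral_le ht
    (fun _ hx => hasDerivAt_regularizedBose hx) integrableOn_regularizedBose
    integrableOn_regularizedBoseDeriv).1
  have hlog := (Real.hasSum_pow_div_log_of_abs_lt_one (norm_exp_neg_lt_one ht)).mul_left t⁻¹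
  have hsplit (m : ℕ) : (Real.exp ((m + 1 : ℕ) * t) - 1)⁻¹ =
      regularizedBose ((m + 1 : ℕ) * t) + t⁻¹ * (Real.exp (-t) ^ (m + 1) / (m + 1)) := by
    rw [regularizedBose, ← Real.exp_nat_mul]
    push_cast
    field_simp
    ring
  simp only [lambert_eq_tsum 0 ht, pow_zero, one_div, hsplit]
  rw [hbose.tsum_add hlog.summable, hlog.tsum_eq]
  field_simp
  ring

lemma isBigO_lambert_zero :
    (fun t => t * lambert 0 t - (Real.eulerMascheroniConstant - Real.log t)) =O[𝓝[>] 0]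
      fun t => t := by
  have hriemann := isBigO_smul_tsum_sub_integral (fun _ hx => hasDerivAt_regularizedBose hx)
    integrableOn_regularizedBose integrableOn_regularizedBoseDeriv
  have hlog : (fun t => Real.log (1 - Real.exp (-t)) - Real.log t) =O[𝓝[>] 0] fun t => t :=
    IsBigO.of_bound 1 (eventually_nhdsWithin_of_forall fun t (ht : 0 < t) => by
      simpa [abs_of_pos ht] using abs_log_one_sub_exp_neg_sub_log_le ht)
  refine (hriemann.sub hlog).congr'
    (eventually_nhdsWithin_of_forall fun t (ht : 0 < t) => ?_) EventuallyEq.rfl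
  simp only [smul_eq_mul, mul_tsum_regularizedBose ht, integral_regularizedBose]
  ring

end EulerMascheroni

section ZetaArguments

/-- The arguments `(γ - log t, ζ(2), 2 ζ(3), …)` of the Bell polynomials as functions of a
positive real `t`; at `t = π / √(6n)` they are `zetaArgs`. -/
noncomputable def zetaArg (t : ℝ) (i : ℕ) : ℝ :=
  if i = 0 then Real.eulerMascheroniConstant - Real.log t
  else i.factorial * (riemannZeta ((i + 1 : ℕ) : ℂ)).re

lemma zetaArg_zero (t : ℝ) : zetaArg t 0 = Real.eulerMascheroniConstant - Real.log t :=
  if_pos rfl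

lemma zetaArg_succ (t : ℝ) (i : ℕ) :
    zetaArg t (i + 1) = (i + 1).factorial * (riemannZeta ((i + 2 : ℕ) : ℂ)).re :=
  if_neg i.succ_ne_zero

lemma one_le_zeta_nat_re {k : ℕ} (hk : 1 < k) : 1 ≤ (riemannZeta (k : ℂ)).re := by
  have hsum : Summable fun n : ℕ => 1 / (n : ℝ) ^ k := Real.summable_one_div_nat_pow.2 hk
  have hzeta : riemannZeta (k : ℂ) = ((∑' n : ℕ, 1 / (n : ℝ) ^ k : ℝ) : ℂ) := by
    rw [zeta_nat_eq_tsum_of_gt_one hk]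
    push_cast
    rfl
  rw [hzeta, Complex.ofReal_re]
  simpa using hsum.le_tsum 1 fun n _ => by positivity

lemma eventually_one_le_zetaArg : ∀ᶠ t in 𝓝[>] 0, ∀ i, 1 ≤ zetaArg t i := by
  filter_upwards [Ioc_mem_nhdsGT (Real.exp_pos (-1))] with t ht i
  rcases i with - | i
  · have hlog := Real.log_le_log ht.1 ht.2
    rw [Real.log_exp] at hlog
    linarith [zetaArg_zero t, Real.one_half_lt_eulerMascheroniConstant]
  · rw [zetaArg_succ]
    exact one_le_mul_of_one_le_of_one_le (mod_cast (i + 1).factorial_pos)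
      (one_le_zeta_nat_re (by lia))

lemma isBigO_lambert_sub_zetaArg (i : ℕ) :
    (fun t => t ^ (i + 1) * lambert i t - zetaArg t i) =O[𝓝[>] 0] fun t => t * zetaArg t i := by
  have hid : (fun t : ℝ => t) =O[𝓝[>] 0] fun t => t * zetaArg t i := by
    refine IsBigO.of_bound 1 ?_
    filter_upwards [eventually_one_le_zetaArg] with t ht
    rw [norm_mul, one_mul]
    exact le_mul_of_one_le_right (norm_nonneg t) ((ht i).trans (le_abs_self _))
  refine IsBigO.trans ?_ hid
  rcases i with - | i
  · simpa [zetaArg_zero] using isBigO_lambert_zero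
  · simpa only [zetaArg_succ] using isBigO_lambert_succ i

lemma isBigO_zetaArg_half (i : ℕ) :
    (fun t => zetaArg (t / 2) i) =O[𝓝[>] 0] fun t => zetaArg t i := by
  rcases i with - | i
  · refine IsBigO.of_bound 2 ?_
    filter_upwards [eventually_one_le_zetaArg, self_mem_nhdsWithin] with t hone (ht : 0 < t)
    have hhalf : zetaArg (t / 2) 0 = zetaArg t 0 + Real.log 2 := by
      rw [zetaArg_zero, zetaArg_zero, Real.log_div ht.ne' two_ne_zero]
      ring
    have hlog := Real.log_two_lt_d9
    have hlog' := Real.log_two_gt_d9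
    have hone₀ := hone 0
    rw [hhalf, Real.norm_of_nonneg (by linarith), Real.norm_of_nonneg (by linarith)]
    linarith
  · simpa only [zetaArg_succ] using isBigO_refl _ _

lemma isBigO_pow_mul_lambert_half (i : ℕ) :
    (fun t => t ^ (i + 1) * lambert i (t / 2)) =O[𝓝[>] 0] fun t => zetaArg t i := by
  have hid : (fun t : ℝ => t * zetaArg t i) =O[𝓝[>] 0] fun t => zetaArg t i := by
    simpa using (tendsto_id.mono_left nhdsWithin_le_nhds).isBigO_one ℝ |>.mul
      (isBigO_refl (fun t => zetaArg t i) (𝓝[>] 0))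
  have hlambert : (fun t => t ^ (i + 1) * lambert i t) =O[𝓝[>] 0] fun t => zetaArg t i := by
    simpa using ((isBigO_lambert_sub_zetaArg i).trans hid).add (isBigO_refl (zetaArg · i) _)
  have hhalf : Tendsto (fun t : ℝ => t / 2) (𝓝[>] 0) (𝓝[>] 0) := by
    refine tendsto_nhdsWithin_iff.2
      ⟨?_, eventually_nhdsWithin_of_forall fun t ht => mem_Ioi.2 (half_pos (mem_Ioi.1 ht))⟩
    simpa using ((continuous_id.div_const (2 : ℝ)).tendsto 0).mono_left nhdsWithin_le_nhds
  refine (((hlambert.comp_tendsto hhalf).trans (isBigO_zetaArg_half i)).const_mul_left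
    (2 ^ (i + 1))).congr_left fun t => ?_
  simp only [Function.comp_apply, div_pow]
  field_simp

end ZetaArguments

end LambertSeries

section GeneratingFunction

open Finset

/-- The power series `1 / (1 - X ^ (i + 1))`. -/
def geomSeries (R : Type*) [Semiring R] (i : ℕ) : PowerSeries R :=
  PowerSeries.mk fun n => if i + 1 ∣ n then 1 else 0

section

open scoped PowerSeries.WithPiTopology

lemma hasSum_X_pow_mul (R : Type*) [TopologicalSpace R] [Semiring R] (i : ℕ) :
    HasSum (fun j : ℕ => (PowerSeries.X : PowerSeries R) ^ ((i + 1) * j)) (geomSeries R i) := by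
  refine (PowerSeries.WithPiTopology.hasSum_iff_hasSum_coeff R).2 fun d => ?_
  simp only [PowerSeries.coeff_X_pow, geomSeries, PowerSeries.coeff_mk]
  split_ifs with h
  · obtain ⟨j, rfl⟩ := h
    convert! hasSum_ite_eq j (1 : R) using 2 with k
    simp [eq_comm]
  · convert! hasSum_zero using 2 with k
    exact if_neg fun hd => h ⟨k, hd⟩

lemma prod_geomSeries (R : Type*) [TopologicalSpace R] [T2Space R] [CommSemiring R]
    [IsTopologicalSemiring R] (M : ℕ) :
    ∏ i ∈ range M, geomSeries R i =
      PowerSeries.mk fun n => (#(Nat.Partition.restricted n (· ≤ M)) : R) := by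
  have hprod := Nat.Partition.hasProd_powerSeriesMk_card_restricted R (· ≤ M)
  simp only [(hasSum_X_pow_mul R _).tsum_eq, Nat.succ_le_iff] at hprod
  refine HasProd.unique ?_ hprod
  rw [← prod_congr rfl fun i hi => if_pos (c := i < M) (e := 1) (mem_range.1 hi)]
  exact hasProd_prod_of_ne_finset_one fun i hi => if_neg (mt mem_range.2 hi)

end

variable {K : Type*} [NormedField K] {q : K}

lemma norm_pow_succ_lt_one (hq : ‖q‖ < 1) (i : ℕ) : ‖q ^ (i + 1)‖ < 1 := by
  rw [norm_pow]
  exact pow_lt_one₀ (norm_nonneg q) hq i.succ_ne_zero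

lemma absHasSum_geomSeries (i : ℕ) (hq : ‖q‖ < 1) :
    AbsHasSum (geomSeries K i) q (1 - q ^ (i + 1))⁻¹ := by
  constructor
  · refine (summable_geometric_of_lt_one (norm_nonneg q) hq).of_nonneg_of_le
      (fun _ => norm_nonneg _) fun n => ?_
    simp only [geomSeries, PowerSeries.coeff_mk]
    split_ifs <;> simp
  · have hinj : Function.Injective ((i + 1) * · : ℕ → ℕ) :=
      mul_right_injective₀ i.succ_ne_zero
    rw [← hinj.hasSum_iff]
    · convert! hasSum_geometric_of_norm_lt_one (norm_pow_succ_lt_one hq i) using 2 with j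
      simp [geomSeries, pow_mul]
    · intro n hn
      have hndvd : ¬ i + 1 ∣ n := fun ⟨j, hj⟩ => hn ⟨j, hj.symm⟩
      simp [geomSeries, hndvd]

lemma absHasSum_card_restricted [CompleteSpace K] (M : ℕ) (hq : ‖q‖ < 1) :
    AbsHasSum (PowerSeries.mk fun n => (#(Nat.Partition.restricted n (· ≤ M)) : K)) q
      (∏ i ∈ range M, (1 - q ^ (i + 1)))⁻¹ := by
  rw [← prod_geomSeries, ← prod_inv_distrib]
  exact AbsHasSum.prod fun i _ => absHasSum_geomSeries i hq

lemma tprod_one_sub_pow_ne_zero [CompleteSpace K] (hq : ‖q‖ < 1) :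
    ∏' i : ℕ, (1 - q ^ (i + 1)) ≠ 0 := by
  have hne (i : ℕ) : 1 + -q ^ (i + 1) ≠ 0 := fun h => by
    have hlt := norm_pow_succ_lt_one hq i
    rw [← add_neg_eq_zero.1 h, norm_one] at hlt
    exact lt_irrefl _ hlt
  simpa only [sub_eq_add_neg] using tprod_one_add_ne_zero_of_summable hne
    (by simpa using (summable_nat_add_iff 1).2 (summable_geometric_of_lt_one (norm_nonneg _) hq))

lemma tendsto_prod_inv [CompleteSpace K] (hq : ‖q‖ < 1) :
    Tendsto (fun M => (∏ i ∈ range M, (1 - q ^ (i + 1)))⁻¹) atTop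
      (nhds (∏' i : ℕ, (1 - q ^ (i + 1)))⁻¹) := by
  have hmul : Multipliable fun i : ℕ => 1 - q ^ (i + 1) := by
    simpa only [sub_eq_add_neg] using multipliable_one_add_of_summable (f := fun i => -q ^ (i + 1))
      (by simpa using (summable_nat_add_iff 1).2 (summable_geometric_of_lt_one (norm_nonneg q) hq))
  exact hmul.hasProd.tendsto_prod_nat.inv₀ (tprod_one_sub_pow_ne_zero hq)

lemma card_restricted_le (n M : ℕ) :
    #(Nat.Partition.restricted n (· ≤ M)) ≤ Fintype.card n.Partition :=
  card_le_univ _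

lemma card_restricted_of_le {n M : ℕ} (h : n ≤ M) :
    #(Nat.Partition.restricted n (· ≤ M)) = Fintype.card n.Partition := by
  rw [← card_univ, Nat.Partition.restricted,
    filter_true_of_mem fun P _ i hi => (P.le_of_mem_parts hi).trans h]

lemma summable_card_partition_mul_pow {x : ℝ} (hx0 : 0 ≤ x) (hx1 : x < 1) :
    Summable fun n : ℕ => (Fintype.card n.Partition : ℝ) * x ^ n := by
  have hx : ‖x‖ < 1 := by rwa [Real.norm_of_nonneg hx0]
  obtain ⟨B, hB⟩ := (tendsto_prod_inv hx).bddAbove_range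
  refine summable_of_sum_range_le (c := B) (fun n => by positivity) fun N => ?_
  have hsum := (absHasSum_card_restricted N hx).2
  simp only [PowerSeries.coeff_mk] at hsum
  calc ∑ n ∈ range N, (Fintype.card n.Partition : ℝ) * x ^ n
      = ∑ n ∈ range N, (#(Nat.Partition.restricted n (· ≤ N)) : ℝ) * x ^ n :=
        sum_congr rfl fun n hn => by rw [card_restricted_of_le (mem_range.1 hn).le]
    _ ≤ (∏ i ∈ range N, (1 - x ^ (i + 1)))⁻¹ :=
        sum_le_hasSum _ (fun n _ => by positivity) hsum
    _ ≤ B := hB ⟨N, rfl⟩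

/-- The generating function `∑ p(n) q ^ n` of the partition numbers. -/
noncomputable def partitionGenFun (q : ℂ) : ℂ := ∑' n : ℕ, (Fintype.card n.Partition : ℂ) * q ^ n

variable {q : ℂ}

lemma summable_norm_card_partition_mul_pow (hq : ‖q‖ < 1) :
    Summable fun n : ℕ => ‖(Fintype.card n.Partition : ℂ) * q ^ n‖ := by
  simpa using summable_card_partition_mul_pow (norm_nonneg q) hq

lemma hasSum_partitionGenFun (hq : ‖q‖ < 1) :
    HasSum (fun n : ℕ => (Fintype.card n.Partition : ℂ) * q ^ n) (partitionGenFun q) :=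
  (summable_norm_card_partition_mul_pow hq).of_norm.hasSum

lemma partitionGenFun_eq (hq : ‖q‖ < 1) :
    partitionGenFun q = (∏' i : ℕ, (1 - q ^ (i + 1)))⁻¹ := by
  refine tendsto_nhds_unique ?_ (tendsto_prod_inv hq)
  have hlim := tendsto_tsum_of_dominated_convergence (𝓕 := atTop)
    (f := fun M n => (#(Nat.Partition.restricted n (· ≤ M)) : ℂ) * q ^ n)
    (g := fun n => (Fintype.card n.Partition : ℂ) * q ^ n)
    (summable_norm_card_partition_mul_pow hq) (fun n => ?_) (Eventually.of_forall fun M n => ?_)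
  · refine hlim.congr fun M => ?_
    simpa only [PowerSeries.coeff_mk] using (absHasSum_card_restricted M hq).2.tsum_eq
  · refine tendsto_const_nhds.congr' ?_
    filter_upwards [eventually_ge_atTop n] with M hM
    rw [card_restricted_of_le hM]
  · rw [norm_mul, norm_mul, Complex.norm_natCast, Complex.norm_natCast]
    gcongr
    exact card_restricted_le n M

lemma one_sub_norm_mul_exp_le {w : ℂ} (hw : ‖w‖ < 1) :
    (1 - ‖w‖) * Real.exp (‖w‖ - w.re) ≤ ‖1 - w‖ := by
  have hcomplex := Complex.hasSum_re (Complex.hasSum_taylorSeries_neg_log hw)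
  have hreal := Complex.hasSum_re (Complex.hasSum_taylorSeries_neg_log
    (z := (‖w‖ : ℂ)) (by simpa using hw))
  have hcoeff (n : ℕ) : 0 ≤ (((‖w‖ : ℂ) ^ n / n).re - (w ^ n / n).re) := by
    rw [sub_nonneg, ← Complex.ofReal_pow, ← Complex.ofReal_natCast, ← Complex.ofReal_div,
      Complex.ofReal_re]
    calc _ ≤ ‖w ^ n / (n : ℝ)‖ := Complex.re_le_norm _
      _ = _ := by simp
  have hfirst := le_hasSum (hreal.sub hcomplex) 1 fun n _ => hcoeff n
  have hpos : 0 < ‖1 - w‖ := norm_pos_iff.2 fun h => by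
    rw [← sub_eq_zero.1 h, norm_one] at hw
    exact lt_irrefl _ hw
  have hnorm : ‖(1 - ‖w‖ : ℂ)‖ = 1 - ‖w‖ := by
    rw [← Complex.ofReal_one, ← Complex.ofReal_sub, Complex.norm_real,
      Real.norm_of_nonneg (by linarith)]
  simp only [pow_one, Nat.cast_one, div_one, Complex.ofReal_re, Complex.neg_re, Complex.log_re,
    hnorm] at hfirst
  rw [← Real.exp_log hpos, ← Real.exp_log (sub_pos.2 hw), ← Real.exp_add, Real.exp_le_exp]
  linarith

end GeneratingFunction

section CircleEstimates

open Complex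
open scoped Real

lemma norm_partitionGenFun_le {q : ℂ} (hq : ‖q‖ < 1) :
    ‖partitionGenFun q‖ ≤ ‖partitionGenFun (‖q‖ : ℂ)‖ *
      Real.exp (-((1 - ‖q‖)⁻¹ - ((1 - q)⁻¹).re)) := by
  have hr : ‖(‖q‖ : ℂ)‖ < 1 := by simpa using hq
  rw [partitionGenFun_eq hq, partitionGenFun_eq hr]
  have hsum : HasSum (fun i : ℕ => ‖q‖ ^ (i + 1) - (q ^ (i + 1)).re)
      ((1 - ‖q‖)⁻¹ - ((1 - q)⁻¹).re) := by
    have h := (hasSum_geometric_of_lt_one (norm_nonneg q) hq).sub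
      (hasSum_re (hasSum_geometric_of_norm_lt_one hq))
    simpa using (hasSum_nat_add_iff' 1).2 h
  refine le_of_tendsto_of_tendsto' (tendsto_prod_inv hq).norm ((tendsto_prod_inv hr).norm.mul
    ((Real.continuous_exp.tendsto _).comp hsum.tendsto_sum_nat.neg)) fun M => ?_
  simp only [Function.comp_apply, norm_inv, norm_prod, ← Finset.sum_neg_distrib, Real.exp_sum,
    ← Finset.prod_inv_distrib]
  rw [← Finset.prod_mul_distrib]
  refine Finset.prod_le_prod (fun i _ => by positivity) fun i _ => ?_
  have hlt := norm_pow_succ_lt_one hq i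
  have hle := one_sub_norm_mul_exp_le hlt
  rw [norm_pow] at hle hlt
  have hnorm : ‖1 - (‖q‖ : ℂ) ^ (i + 1)‖ = 1 - ‖q‖ ^ (i + 1) := by
    rw [← ofReal_pow, ← ofReal_one, ← ofReal_sub, norm_real, Real.norm_of_nonneg (by linarith)]
  rw [hnorm, Real.exp_neg, ← mul_inv]
  exact inv_anti₀ (mul_pos (by linarith) (Real.exp_pos _)) hle

lemma norm_exp_neg_lt_one_of_re_pos {z : ℂ} (hz : 0 < z.re) : ‖exp (-z)‖ < 1 := by
  rw [norm_exp, Real.exp_lt_one_iff, neg_re]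
  linarith

lemma eta_I_mul_div_two_pi {z : ℂ} (hz : 0 < z.re) :
    ModularForm.eta (I * (z / (2 * π))) =
      exp (-(z / 24)) * (partitionGenFun (exp (-z)))⁻¹ := by
  have hπ : (π : ℂ) ≠ 0 := ofReal_ne_zero.2 Real.pi_ne_zero
  rw [partitionGenFun_eq (norm_exp_neg_lt_one_of_re_pos hz), inv_inv, ModularForm.eta,
    Function.Periodic.qParam]
  congr 2
  · push_cast
    field_simp
    linear_combination z * I_sq
  · funext n
    rw [ModularForm.eta_q_eq_pow]
    congr 3
    field_simp
    linear_combination z * I_sq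

lemma ofReal_div_re_pos {a : ℝ} (ha : 0 < a) {z : ℂ} (hz : 0 < z.re) : 0 < (a / z).re := by
  have hz0 : 0 < normSq z := normSq_pos.2 fun h => by simp [h] at hz
  rw [div_eq_mul_inv, re_ofReal_mul, inv_re]
  positivity

lemma sqrt_I_inv_mul_sqrt {w : ℂ} (hw : 0 < w.re) : (sqrt I)⁻¹ * sqrt (I * w) = sqrt w := by
  have hw0 : w ≠ 0 := fun h => by simp [h] at hw
  have hlog : log (I * w) = log I + log w := by
    rw [log_mul_eq_add_log_iff I_ne_zero hw0, arg_I]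
    have harg := abs_lt.1 (abs_arg_lt_pi_div_two_iff.2 (Or.inl hw))
    constructor <;> linarith [harg.1, harg.2, Real.pi_pos]
  rw [sqrt_eq_exp I_ne_zero, sqrt_eq_exp (mul_ne_zero I_ne_zero hw0), sqrt_eq_exp hw0, hlog,
    ← exp_neg, ← exp_add]
  congr 1
  ring

/-- The leading term of `partitionGenFun (exp (-z))` as `z → 0` inside a sector, obtained from the
transformation of the Dedekind eta function under `τ ↦ -1 / τ`. -/
noncomputable def partitionGenFunApprox (z : ℂ) : ℂ :=
  sqrt (z / (2 * π)) * exp (π ^ 2 / (6 * z))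

lemma partitionGenFun_exp_neg {z : ℂ} (hz : 0 < z.re) :
    partitionGenFun (exp (-z)) = partitionGenFunApprox z *
      (exp (-(z / 24)) * partitionGenFun (exp (-((4 * π ^ 2 : ℝ) / z)))) := by
  have hπ : (π : ℂ) ≠ 0 := ofReal_ne_zero.2 Real.pi_ne_zero
  have hz0 : z ≠ 0 := fun h => by simp [h] at hz
  have hdual := ofReal_div_re_pos (show 0 < 4 * π ^ 2 by positivity) hz
  have hw : 0 < (z / (2 * π)).re := by
    rw [← ofReal_ofNat, ← ofReal_mul, div_ofReal_re]
    positivity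
  have hmodular := ModularForm.eta_comp_eq_csqrt_I_inv
    (show I * (z / (2 * π)) ∈ UpperHalfPlane.upperHalfPlaneSet by
      simpa [UpperHalfPlane.upperHalfPlaneSet] using hw)
  have hinv : -1 / (I * (z / (2 * π))) = I * ((4 * π ^ 2 : ℝ) / z / (2 * π)) := by
    push_cast
    field_simp
    linear_combination -4 * I_sq
  simp only [Function.comp_apply, Pi.smul_apply, Pi.mul_apply, smul_eq_mul, hinv] at hmodular
  rw [← mul_assoc, sqrt_I_inv_mul_sqrt hw, eta_I_mul_div_two_pi hz,
    eta_I_mul_div_two_pi hdual] at hmodular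
  have hexp : exp (-((4 * π ^ 2 : ℝ) / (z * 24))) * exp (π ^ 2 / (6 * z)) = 1 := by
    rw [← exp_add, exp_eq_one_iff]
    refine ⟨0, ?_⟩
    push_cast
    field_simp
    ring
  have hF : partitionGenFun (exp (-z)) ≠ 0 := by
    rw [partitionGenFun_eq (norm_exp_neg_lt_one_of_re_pos hz)]
    exact inv_ne_zero (tprod_one_sub_pow_ne_zero (norm_exp_neg_lt_one_of_re_pos hz))
  have hF' : partitionGenFun (exp (-((4 * π ^ 2 : ℝ) / z))) ≠ 0 := by
    rw [partitionGenFun_eq (norm_exp_neg_lt_one_of_re_pos hdual)]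
    exact inv_ne_zero (tprod_one_sub_pow_ne_zero (norm_exp_neg_lt_one_of_re_pos hdual))
  field_simp at hmodular
  rw [partitionGenFunApprox]
  linear_combination (-partitionGenFun (exp (-z))) * hexp + exp (π ^ 2 / (6 * z)) * hmodular

lemma norm_partitionGenFun_sub_one_le : ∃ K : ℝ, 0 ≤ K ∧ ∀ q : ℂ, ‖q‖ ≤ 1 / 2 →
    ‖partitionGenFun q - 1‖ ≤ K * ‖q‖ := by
  have hsummable : Summable fun n : ℕ =>
      (Fintype.card (n + 1).Partition : ℝ) * (1 / 2) ^ n := by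
    refine (((summable_nat_add_iff 1).2 (summable_card_partition_mul_pow (x := 1 / 2)
      (by norm_num) (by norm_num))).mul_left 2).congr fun n => ?_
    rw [pow_succ]
    ring
  refine ⟨∑' n : ℕ, (Fintype.card (n + 1).Partition : ℝ) * (1 / 2) ^ n,
    tsum_nonneg fun n => by positivity, fun q hq => ?_⟩
  have htail : HasSum (fun n : ℕ => (Fintype.card (n + 1).Partition : ℂ) * q ^ (n + 1))
      (partitionGenFun q - 1) := by
    simpa using (hasSum_nat_add_iff' 1).2 (hasSum_partitionGenFun (q := q) (by linarith))
  refine htail.norm_le_of_bounded (hsummable.hasSum.mul_right ‖q‖) fun n => ?_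
  rw [norm_mul, norm_pow, pow_succ, norm_natCast, ← mul_assoc]
  gcongr

lemma nine_lt_pi_sq : 9 < π ^ 2 := by nlinarith [Real.pi_gt_three]

lemma norm_exp_neg_dual_le {z : ℂ} (hz : 0 < z.re) (him : |z.im| ≤ z.re / 2) :
    ‖exp (-((4 * π ^ 2 : ℝ) / z))‖ ≤ z.re / 9 := by
  have hz0 : 0 < normSq z := normSq_pos.2 fun h => by simp [h] at hz
  have hre : 9 / z.re ≤ ((4 * π ^ 2 : ℝ) / z).re := by
    have him2 : z.im ^ 2 ≤ (z.re / 2) ^ 2 := by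
      rw [← sq_abs]
      gcongr
    rw [div_eq_mul_inv ((4 * π ^ 2 : ℝ) : ℂ), re_ofReal_mul, inv_re, mul_div_assoc',
      div_le_div_iff₀ hz hz0, normSq_apply]
    nlinarith [mul_lt_mul_of_pos_right nine_lt_pi_sq (mul_pos hz hz)]
  rw [norm_exp, neg_re, Real.exp_neg]
  refine inv_le_of_inv_le₀ (by positivity) ?_
  rw [inv_div]
  linarith [Real.add_one_le_exp ((4 * π ^ 2 : ℝ) / z).re]

lemma norm_partitionGenFun_sub_approx_le : ∃ C : ℝ, 0 ≤ C ∧ ∀ z : ℂ, 0 < z.re → z.re ≤ 1 →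
    |z.im| ≤ z.re / 2 → ‖partitionGenFun (exp (-z)) - partitionGenFunApprox z‖ ≤
      C * z.re * ‖partitionGenFunApprox z‖ := by
  obtain ⟨K, hK, hF⟩ := norm_partitionGenFun_sub_one_le
  refine ⟨1 + 2 * K, by positivity, fun z hz hz1 him => ?_⟩
  set q' := exp (-((4 * π ^ 2 : ℝ) / z))
  have hq' : ‖q'‖ ≤ z.re / 9 := norm_exp_neg_dual_le hz him
  have hF' : ‖partitionGenFun q' - 1‖ ≤ K * z.re :=
    (hF q' (by linarith)).trans (by gcongr; linarith)
  have hexp : ‖exp (-(z / 24)) - 1‖ ≤ z.re := by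
    have hz2 : ‖-(z / 24)‖ ≤ z.re / 2 := by
      have := norm_le_abs_re_add_abs_im z
      rw [abs_of_pos hz] at this
      simp only [norm_neg, norm_div, norm_ofNat]
      linarith
    exact (norm_exp_sub_one_le (hz2.trans (by linarith))).trans (by linarith)
  have hsplit : partitionGenFun (exp (-z)) - partitionGenFunApprox z =
      ((exp (-(z / 24)) - 1) * (partitionGenFun q' - 1) + (exp (-(z / 24)) - 1) +
        (partitionGenFun q' - 1)) * partitionGenFunApprox z := by
    rw [partitionGenFun_exp_neg hz]
    ring
  rw [hsplit, norm_mul]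
  gcongr
  calc ‖_‖ ≤ ‖exp (-(z / 24)) - 1‖ * ‖partitionGenFun q' - 1‖ + ‖exp (-(z / 24)) - 1‖ +
        ‖partitionGenFun q' - 1‖ := (norm_add₃_le).trans_eq (by rw [norm_mul])
    _ ≤ 1 * (K * z.re) + z.re + K * z.re := by gcongr; linarith
    _ = (1 + 2 * K) * z.re := by ring

end CircleEstimates

section SaddlePoint

open Complex
open scoped Real

/-- The exponent of the integrand at the point `t (1 + i u)` of the circle, after removal of its
value `2 N` at the saddle point `u = 0` and of its Gaussian part `-N u ^ 2`, where
`N = π ^ 2 / (6 t)`. -/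
noncomputable def saddleExponent (N u : ℝ) : ℂ :=
  log (1 + u * I) / 2 + ((N / (1 + u ^ 2) * u ^ 4 : ℝ) + (N / (1 + u ^ 2) * u ^ 3 : ℝ) * I)

lemma one_add_mul_I_ne_zero (u : ℝ) : (1 + u * I : ℂ) ≠ 0 := fun h => by
  simpa using congrArg re h

lemma saddleExponent_identity (N u : ℝ) :
    (N : ℂ) / (1 + u * I) + N * (1 + u * I) + log (1 + u * I) / 2 =
      ((2 * N : ℝ) : ℂ) + ((-N * u ^ 2 : ℝ) : ℂ) + saddleExponent N u := by
  have hu : (1 + (u : ℂ) ^ 2) ≠ 0 := mod_cast (by positivity : (1 + u ^ 2 : ℝ) ≠ 0)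
  have hdiv : (N : ℂ) / (1 + u * I) = N * (1 - u * I) / (1 + (u : ℂ) ^ 2) := by
    rw [div_eq_div_iff (one_add_mul_I_ne_zero u) hu]
    linear_combination (N : ℂ) * u ^ 2 * I_sq
  rw [saddleExponent, hdiv]
  push_cast
  field_simp
  ring

lemma saddleExponent_re (N u : ℝ) :
    (saddleExponent N u).re = Real.log (1 + u ^ 2) / 4 + N * u ^ 4 / (1 + u ^ 2) := by
  have hnorm : Real.log (1 + u ^ 2) = 2 * Real.log ‖(1 + u * I : ℂ)‖ := by
    rw [show 1 + u ^ 2 = ‖(1 + u * I : ℂ)‖ ^ 2 by rw [Complex.sq_norm, normSq_apply]; simp [sq],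
      Real.log_pow, Nat.cast_ofNat]
  rw [saddleExponent, hnorm, ← log_re]
  simp only [add_re, div_ofNat_re, ofReal_re, re_ofReal_mul, I_re]
  ring

lemma saddleExponent_im (N u : ℝ) :
    (saddleExponent N u).im = (log (1 + u * I)).im / 2 + N * u ^ 3 / (1 + u ^ 2) := by
  rw [saddleExponent]
  simp only [add_im, div_ofNat_im, ofReal_im, im_ofReal_mul, I_im]
  ring

lemma saddleExponent_re_nonneg {N : ℝ} (hN : 0 ≤ N) (u : ℝ) : 0 ≤ (saddleExponent N u).re := by
  have hlog := Real.log_nonneg (le_add_of_nonneg_right (sq_nonneg u) : 1 ≤ 1 + u ^ 2)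
  rw [saddleExponent_re]
  positivity

lemma saddleExponent_re_le {N : ℝ} (hN : 0 ≤ N) (u : ℝ) :
    (saddleExponent N u).re ≤ u ^ 2 * (1 / 4 + N * u ^ 2) := by
  have hlog := Real.log_le_sub_one_of_pos (show 0 < 1 + u ^ 2 by positivity)
  have hdiv : N * u ^ 4 / (1 + u ^ 2) ≤ N * u ^ 4 :=
    div_le_self (by positivity) (by linarith [sq_nonneg u])
  rw [saddleExponent_re]
  linarith

lemma exp_neg_mul_exp_saddleExponent_re_le {N u : ℝ} (hN : 0 ≤ N) (hu : |u| ≤ 1 / 2) :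
    Real.exp (-N * u ^ 2) * Real.exp (saddleExponent N u).re ≤
      3 * Real.exp (-(4 * (N * u ^ 2) / 5)) := by
  have hu2 : u ^ 2 ≤ 1 / 4 := by
    rw [← sq_abs]
    nlinarith [abs_nonneg u]
  have hre : (saddleExponent N u).re ≤ 1 + N * u ^ 2 / 5 := by
    have hlog := Real.log_le_sub_one_of_pos (show 0 < 1 + u ^ 2 by positivity)
    have hdiv : N * u ^ 4 / (1 + u ^ 2) ≤ N * u ^ 2 / 5 := by
      rw [div_le_div_iff₀ (by positivity) (by norm_num)]
      nlinarith [mul_nonneg hN (sq_nonneg u)]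
    rw [saddleExponent_re]
    linarith
  calc Real.exp (-N * u ^ 2) * Real.exp (saddleExponent N u).re
      ≤ Real.exp 1 * Real.exp (-(4 * (N * u ^ 2) / 5)) := by
        rw [← Real.exp_add, ← Real.exp_add, Real.exp_le_exp]
        linarith
    _ ≤ 3 * Real.exp (-(4 * (N * u ^ 2) / 5)) := by
        gcongr
        exact Real.exp_one_lt_three.le

lemma abs_saddleExponent_im_le {N u : ℝ} (hN : 0 ≤ N) (hu : |u| ≤ 1 / 2) :
    |(saddleExponent N u).im| ≤ |u| * (1 + N * u ^ 2) := by
  have hlog : |(log (1 + u * I)).im| ≤ 3 / 2 * |u| := by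
    have hnorm : ‖(u * I : ℂ)‖ = |u| := by simp
    simpa only [hnorm] using (abs_im_le_norm _).trans
      (norm_log_one_add_half_le_self (z := (u : ℂ) * I) (hnorm.trans_le hu))
  have hdiv : |N * u ^ 3 / (1 + u ^ 2)| ≤ N * |u| ^ 3 := by
    rw [abs_div, abs_mul, abs_pow, abs_of_nonneg hN, abs_of_pos (show 0 < 1 + u ^ 2 by positivity)]
    exact div_le_self (by positivity) (by linarith [sq_nonneg u])
  rw [saddleExponent_im]
  calc |(log (1 + u * I)).im / 2 + N * u ^ 3 / (1 + u ^ 2)|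
      ≤ |(log (1 + u * I)).im| / 2 + |N * u ^ 3 / (1 + u ^ 2)| := by
        refine (abs_add_le _ _).trans_eq ?_
        rw [abs_div _ (2 : ℝ), abs_two]
    _ ≤ |u| * (1 + N * |u| ^ 2) := by nlinarith [abs_nonneg u]
    _ = |u| * (1 + N * u ^ 2) := by rw [sq_abs]

lemma abs_exp_mul_cos_sub_one_le {a b : ℝ} (ha : 0 ≤ a) :
    |Real.exp a * Real.cos b - 1| ≤ Real.exp a * (a + b ^ 2 / 2) := by
  have hexp : Real.exp a - 1 ≤ Real.exp a * a := by
    have hle := mul_le_mul_of_nonneg_left (Real.add_one_le_exp (-a)) (Real.exp_nonneg a)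
    rw [← Real.exp_add, add_neg_cancel, Real.exp_zero] at hle
    linarith
  have hlower := mul_le_mul_of_nonneg_left (Real.one_sub_sq_div_two_le_cos (x := b))
    (Real.exp_nonneg a)
  have hupper := mul_le_of_le_one_right (Real.exp_nonneg a) (Real.cos_le_one b)
  have : 0 ≤ Real.exp a * (b ^ 2 / 2) := by positivity
  rw [abs_le]
  constructor <;> nlinarith [Real.one_le_exp ha]

lemma add_sq_add_cube_le_exp {v : ℝ} (hv : 0 ≤ v) :
    v + v ^ 2 + v ^ 3 ≤ 250 * Real.exp (3 * v / 10) := by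
  have hx : 0 ≤ 3 * v / 10 := by positivity
  have hlin := Real.pow_div_factorial_le_exp _ hx 1
  have hquad := Real.pow_div_factorial_le_exp _ hx 2
  have hcubic := Real.pow_div_factorial_le_exp _ hx 3
  norm_num [Nat.factorial] at hlin hquad hcubic
  nlinarith

lemma exp_neg_mul_norm_exp_saddleExponent_le {N u w : ℝ} (hN : 0 ≤ N) (hu : |u| ≤ 1 / 2) :
    ‖(Real.exp (-N * u ^ 2) : ℂ) * exp (saddleExponent N u - w * u * I)‖ ≤
      3 * Real.exp (-(N / 2) * u ^ 2) := by
  rw [norm_mul, norm_real, Real.norm_of_nonneg (Real.exp_nonneg _), norm_exp, sub_re]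
  have hre : (w * u * I : ℂ).re = 0 := by simp
  rw [hre, sub_zero]
  refine (exp_neg_mul_exp_saddleExponent_re_le hN hu).trans ?_
  gcongr
  linarith [mul_nonneg hN (sq_nonneg u)]

lemma saddleExponent_re_add_sq_im_le {N u : ℝ} (w : ℝ) (hN : 0 < N) (hu : |u| ≤ 1 / 2) :
    (saddleExponent N u).re + ((saddleExponent N u).im - w * u) ^ 2 / 2 ≤
      4 * (1 + w ^ 2) * (N * u ^ 2 + (N * u ^ 2) ^ 2 + (N * u ^ 2) ^ 3) / N := by
  have him : (saddleExponent N u).im ^ 2 ≤ u ^ 2 * (1 + N * u ^ 2) ^ 2 := by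
    simpa only [mul_pow, sq_abs] using
      pow_le_pow_left₀ (abs_nonneg _) (abs_saddleExponent_im_le hN.le hu) 2
  have hre := saddleExponent_re_le hN.le u
  have hv : 0 ≤ N * u ^ 2 := by positivity
  have hdiv : 4 * (1 + w ^ 2) * (N * u ^ 2 + (N * u ^ 2) ^ 2 + (N * u ^ 2) ^ 3) / N =
      u ^ 2 * (4 * (1 + w ^ 2) * (1 + N * u ^ 2 + (N * u ^ 2) ^ 2)) := by
    field_simp
  calc (saddleExponent N u).re + ((saddleExponent N u).im - w * u) ^ 2 / 2
      ≤ (saddleExponent N u).re + ((saddleExponent N u).im ^ 2 + u ^ 2 * w ^ 2) := by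
        nlinarith [sq_nonneg ((saddleExponent N u).im + w * u)]
    _ ≤ u ^ 2 * ((1 / 4 + N * u ^ 2) + (1 + N * u ^ 2) ^ 2 + w ^ 2) := by linarith
    _ ≤ u ^ 2 * (4 * (1 + w ^ 2) * (1 + N * u ^ 2 + (N * u ^ 2) ^ 2)) := by
        gcongr
        nlinarith [mul_nonneg (sq_nonneg w) hv, mul_nonneg (sq_nonneg w) (sq_nonneg (N * u ^ 2)),
          sq_nonneg w]
    _ = _ := hdiv.symm

lemma abs_exp_saddleExponent_sub_gaussian_le {N u : ℝ} (w : ℝ) (hN : 0 < N) (hu : |u| ≤ 1 / 2) :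
    |((Real.exp (-N * u ^ 2) : ℂ) * exp (saddleExponent N u - w * u * I)).re -
      Real.exp (-N * u ^ 2)| ≤ 3000 / N * (1 + w ^ 2) * Real.exp (-(N / 2) * u ^ 2) := by
  set h := saddleExponent N u
  set v := N * u ^ 2
  have hsplit : ((Real.exp (-N * u ^ 2) : ℂ) * exp (h - w * u * I)).re - Real.exp (-N * u ^ 2) =
      Real.exp (-N * u ^ 2) * (Real.exp h.re * Real.cos (h.im - w * u) - 1) := by
    rw [re_ofReal_mul, exp_re, sub_re, sub_im, ← ofReal_mul, re_ofReal_mul, im_ofReal_mul, I_re,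
      I_im, mul_zero, mul_one, sub_zero]
    ring
  rw [hsplit, abs_mul, abs_of_pos (Real.exp_pos _)]
  calc Real.exp (-N * u ^ 2) * |Real.exp h.re * Real.cos (h.im - w * u) - 1|
      ≤ Real.exp (-N * u ^ 2) * (Real.exp h.re *
          (4 * (1 + w ^ 2) * (v + v ^ 2 + v ^ 3) / N)) := by
        gcongr
        refine (abs_exp_mul_cos_sub_one_le (saddleExponent_re_nonneg hN.le u)).trans ?_
        gcongr
        exact saddleExponent_re_add_sq_im_le w hN hu
    _ ≤ 3 * Real.exp (-(4 * v / 5)) *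
          (4 * (1 + w ^ 2) * (250 * Real.exp (3 * v / 10)) / N) := by
        rw [← mul_assoc]
        refine mul_le_mul (exp_neg_mul_exp_saddleExponent_re_le hN.le hu) ?_ (by positivity)
          (by positivity)
        gcongr
        exact add_sq_add_cube_le_exp (by positivity)
    _ = 3000 / N * (1 + w ^ 2) * (Real.exp (-(4 * v / 5)) * Real.exp (3 * v / 10)) := by ring
    _ = 3000 / N * (1 + w ^ 2) * Real.exp (-(N / 2) * u ^ 2) := by
        rw [← Real.exp_add]
        congr 2
        ring

end SaddlePoint

section CauchyIntegral

open Complex MeasureTheory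
open scoped Real

/-- The parametrisation of the vertical line of abscissa `t`, that is, of the circle of radius
`exp (-t)` in the variable `exp (-z)`. -/
noncomputable def circlePoint (t u : ℝ) : ℂ := t * (1 + u * I)

lemma circlePoint_re (t u : ℝ) : (circlePoint t u).re = t := by simp [circlePoint]

lemma circlePoint_im (t u : ℝ) : (circlePoint t u).im = t * u := by simp [circlePoint]

@[fun_prop]
lemma continuous_circlePoint (t : ℝ) : Continuous (circlePoint t) := by
  unfold circlePoint
  fun_prop

lemma norm_exp_neg_circlePoint (t u : ℝ) : ‖exp (-circlePoint t u)‖ = Real.exp (-t) := by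
  rw [norm_exp, neg_re, circlePoint_re]

lemma norm_exp_neg_circlePoint_lt_one {t : ℝ} (ht : 0 < t) (u : ℝ) :
    ‖exp (-circlePoint t u)‖ < 1 :=
  norm_exp_neg_lt_one_of_re_pos (by rwa [circlePoint_re])

lemma norm_exp_mul_circlePoint (x t u : ℝ) : ‖exp (x * circlePoint t u)‖ = Real.exp (x * t) := by
  rw [norm_exp, re_ofReal_mul, circlePoint_re]

/-- The integrand of Cauchy's formula for the coefficient of index `x` of the generating function
of partitions. -/
noncomputable def saddleIntegrand (x t u : ℝ) : ℂ :=
  partitionGenFun (exp (-circlePoint t u)) * exp (x * circlePoint t u)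

lemma integral_exp_circlePoint {t : ℝ} (ht : 0 < t) (k : ℤ) :
    ∫ u in (-(π / t))..(π / t), exp (k * circlePoint t u) =
      if k = 0 then 2 * (π : ℂ) / t else 0 := by
  have htc : (t : ℂ) ≠ 0 := ofReal_ne_zero.2 ht.ne'
  split_ifs with hk
  · simp [hk]
    ring
  · have hk' : (k : ℂ) * t * I ≠ 0 := by simp [hk, htc]
    have hperiod : exp (k * t * I * ((π / t : ℝ) : ℂ)) = exp (k * t * I * (-(π / t) : ℝ)) := by
      rw [exp_eq_exp_iff_exists_int]
      refine ⟨k, ?_⟩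
      push_cast
      field_simp
      ring
    have hsplit (u : ℝ) : exp (k * circlePoint t u) = exp (k * t) * exp (k * t * I * u) := by
      rw [← exp_add, circlePoint]
      congr 1
      ring
    simp only [hsplit]
    rw [intervalIntegral.integral_const_mul, integral_exp_mul_complex hk', hperiod, sub_self,
      zero_div, mul_zero]

lemma hasSum_saddleIntegrand (x : ℝ) {t : ℝ} (ht : 0 < t) (u : ℝ) :
    HasSum (fun j : ℕ => (Fintype.card j.Partition : ℂ) * exp ((x - j) * circlePoint t u))
      (saddleIntegrand x t u) := by
  refine ((hasSum_partitionGenFun (norm_exp_neg_circlePoint_lt_one ht u)).mul_right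
    (exp (x * circlePoint t u))).congr_fun fun j => ?_
  rw [mul_assoc, ← exp_nat_mul, ← exp_add]
  congr 2
  ring

lemma norm_card_mul_exp_circlePoint (x t u : ℝ) (j : ℕ) :
    ‖(Fintype.card j.Partition : ℂ) * exp ((x - j) * circlePoint t u)‖ =
      Fintype.card j.Partition * Real.exp (-t) ^ j * Real.exp (x * t) := by
  rw [norm_mul, norm_natCast, ← ofReal_natCast j, ← ofReal_sub, norm_exp_mul_circlePoint,
    ← Real.exp_nat_mul, mul_assoc, ← Real.exp_add]
  congr 2
  ring

lemma summable_card_mul_exp_neg_pow_mul (x : ℝ) {t : ℝ} (ht : 0 < t) :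
    Summable fun j : ℕ => (Fintype.card j.Partition : ℝ) * Real.exp (-t) ^ j * Real.exp (x * t) :=
  (summable_card_partition_mul_pow (Real.exp_nonneg _)
    (Real.exp_lt_one_iff.2 (neg_lt_zero.2 ht))).mul_right _

lemma continuous_saddleIntegrand (x : ℝ) {t : ℝ} (ht : 0 < t) :
    Continuous (saddleIntegrand x t) := by
  rw [funext fun u => (hasSum_saddleIntegrand x ht u).tsum_eq.symm]
  exact continuous_tsum (fun j => by fun_prop) (summable_card_mul_exp_neg_pow_mul x ht)
    fun j u => (norm_card_mul_exp_circlePoint x t u j).le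

/-- The number of partitions of `n - m`, which is zero for `n < m`. -/
def shiftedCard (n m : ℕ) : ℕ := if m ≤ n then Fintype.card (n - m).Partition else 0

lemma hasSum_shiftedCard (n m : ℕ) (a : ℂ) :
    HasSum (fun j : ℕ => Fintype.card j.Partition * if (n : ℤ) - m - j = 0 then a else 0)
      (shiftedCard n m * a) := by
  rw [shiftedCard]
  split_ifs with hmn
  · convert! hasSum_single (n - m) fun j hj => ?_ using 2
    · rw [if_pos (by omega)]
    · rw [if_neg (by omega), mul_zero]
  · rw [Nat.cast_zero, zero_mul]
    convert! hasSum_zero using 2 with j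
    rw [if_neg (by omega), mul_zero]

lemma integral_saddleIntegrand (n m : ℕ) {t : ℝ} (ht : 0 < t) :
    ∫ u in (-(π / t))..(π / t), saddleIntegrand (n - m) t u =
      shiftedCard n m * (2 * π / t) := by
  have h := intervalIntegral.hasSum_integral_of_dominated_convergence
    (μ := volume) (a := -(π / t)) (b := π / t) (fun (j : ℕ) _ => _)
    (fun (j : ℕ) => (by fun_prop : Continuous fun u => (Fintype.card j.Partition : ℂ) *
      exp (((n - m : ℝ) - j) * circlePoint t u)).aestronglyMeasurable)
    (fun j => Eventually.of_forall fun u _ => (norm_card_mul_exp_circlePoint _ t u j).le)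
    (Eventually.of_forall fun u _ => summable_card_mul_exp_neg_pow_mul _ ht)
    intervalIntegrable_const
    (Eventually.of_forall fun u _ => hasSum_saddleIntegrand _ ht u)
  have hcoeff (j : ℕ) : ((n - m : ℝ) - j : ℂ) = ((n - m - j : ℤ) : ℂ) := by push_cast; rfl
  simp only [intervalIntegral.integral_const_mul, hcoeff, integral_exp_circlePoint ht] at h
  exact h.unique (hasSum_shiftedCard n m _)

end CauchyIntegral

section SaddleEstimates

open Complex
open scoped Real

/-- The modulus of the leading term of the integrand at the saddle point. -/
noncomputable def saddleSize (t : ℝ) : ℝ := √(t / (2 * π)) * Real.exp (2 * (π ^ 2 / (6 * t)))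

lemma saddleSize_pos {t : ℝ} (ht : 0 < t) : 0 < saddleSize t := by
  unfold saddleSize
  positivity

lemma partitionGenFunApprox_circlePoint {t : ℝ} (ht : 0 < t) (u : ℝ) :
    partitionGenFunApprox (circlePoint t u) = √(t / (2 * π)) * exp (log (1 + u * I) / 2) *
      exp ((π ^ 2 / (6 * t) : ℝ) / (1 + u * I)) := by
  have hu := one_add_mul_I_ne_zero u
  have ht2 : 0 < t / (2 * π) := by positivity
  have htc : (t : ℂ) ≠ 0 := ofReal_ne_zero.2 ht.ne'
  have hmul : circlePoint t u / (2 * π) = ((t / (2 * π) : ℝ) : ℂ) * (1 + u * I) := by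
    rw [circlePoint]
    push_cast
    ring
  have hdiv : (π : ℂ) ^ 2 / (6 * circlePoint t u) = (π ^ 2 / (6 * t) : ℝ) / (1 + u * I) := by
    rw [circlePoint]
    push_cast
    field_simp
  rw [partitionGenFunApprox, hmul, hdiv, sqrt_eq_exp (mul_ne_zero (ofReal_ne_zero.2 ht2.ne') hu),
    log_ofReal_mul ht2 hu, add_div, exp_add, ← Real.exp_log (Real.sqrt_pos.2 ht2),
    Real.log_sqrt ht2.le]
  push_cast
  rfl

lemma partitionGenFunApprox_mul_exp {n t : ℝ} (ht : 0 < t) (hn : n * t = π ^ 2 / (6 * t))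
    (m u : ℝ) :
    partitionGenFunApprox (circlePoint t u) * exp ((n - m : ℝ) * circlePoint t u) =
      (saddleSize t * Real.exp (-(m * t)) : ℝ) * (Real.exp (-(π ^ 2 / (6 * t)) * u ^ 2) *
        exp (saddleExponent (π ^ 2 / (6 * t)) u - (m * t : ℝ) * u * I)) := by
  have hid := saddleExponent_identity (π ^ 2 / (6 * t)) u
  rw [partitionGenFunApprox_circlePoint ht, saddleSize]
  rw [← hn] at hid ⊢
  simp only [ofReal_mul, ofReal_exp, mul_assoc, ← exp_add]
  congr 2
  simp only [circlePoint]
  push_cast at hid ⊢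
  linear_combination hid

lemma inv_le_pi_sq_div {t : ℝ} (ht : 0 < t) : t⁻¹ ≤ π ^ 2 / (6 * t) := by
  rw [inv_eq_one_div, div_le_div_iff₀ ht (by positivity)]
  nlinarith [nine_lt_pi_sq]

lemma norm_saddleIntegrand_sub_approx_le : ∃ C : ℝ, 0 ≤ C ∧ ∀ x t u : ℝ, 0 < t → t ≤ 1 →
    |u| ≤ 1 / 2 →
      ‖saddleIntegrand x t u - partitionGenFunApprox (circlePoint t u) *
        exp (x * circlePoint t u)‖ ≤
      C * t * ‖partitionGenFunApprox (circlePoint t u) * exp (x * circlePoint t u)‖ := by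
  obtain ⟨C, hC, hF⟩ := norm_partitionGenFun_sub_approx_le
  refine ⟨C, hC, fun x t u ht ht1 hu => ?_⟩
  have hle := hF (circlePoint t u) (by rwa [circlePoint_re]) (by rwa [circlePoint_re]) (by
    rw [circlePoint_re, circlePoint_im, abs_mul, abs_of_pos ht]
    nlinarith)
  rw [circlePoint_re] at hle
  rw [saddleIntegrand, ← sub_mul, norm_mul, norm_mul, ← mul_assoc]
  gcongr

lemma abs_saddleIntegrand_sub_gaussian_le : ∃ C : ℝ, 0 ≤ C ∧ ∀ n m t u : ℝ, 0 < t → t ≤ 1 →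
    n * t = π ^ 2 / (6 * t) → |u| ≤ 1 / 2 →
      |(saddleIntegrand (n - m) t u).re -
        saddleSize t * Real.exp (-(m * t)) * Real.exp (-(π ^ 2 / (6 * t)) * u ^ 2)| ≤
      saddleSize t * Real.exp (-(m * t)) *
        (C * t * (1 + (m * t) ^ 2) * Real.exp (-(π ^ 2 / (6 * t) / 2) * u ^ 2)) := by
  obtain ⟨C, hC, hJ⟩ := norm_saddleIntegrand_sub_approx_le
  refine ⟨3000 + 3 * C, by positivity, fun n m t u ht ht1 hn hu => ?_⟩
  have hN := inv_le_pi_sq_div ht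
  have herror := hJ (n - m) t u ht ht1 hu
  rw [partitionGenFunApprox_mul_exp ht hn m u] at herror
  set N := π ^ 2 / (6 * t)
  set S := saddleSize t * Real.exp (-(m * t))
  set gauss := (Real.exp (-N * u ^ 2) : ℂ) * exp (saddleExponent N u - (m * t : ℝ) * u * I)
  have hS0 : 0 < S := mul_pos (saddleSize_pos ht) (Real.exp_pos _)
  have hN0 : 0 < N := (inv_pos.2 ht).trans_le hN
  have hmain := abs_exp_saddleExponent_sub_gaussian_le (m * t) hN0 hu
  have hnorm : ‖gauss‖ ≤ 3 * Real.exp (-(N / 2) * u ^ 2) :=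
    exp_neg_mul_norm_exp_saddleExponent_le hN0.le hu
  rw [norm_mul, norm_real, Real.norm_of_nonneg hS0.le] at herror
  have hsplit : (saddleIntegrand (n - m) t u).re - S * Real.exp (-N * u ^ 2) =
      S * (gauss.re - Real.exp (-N * u ^ 2)) + (saddleIntegrand (n - m) t u - S * gauss).re := by
    rw [sub_re, re_ofReal_mul S gauss]
    ring
  rw [hsplit]
  calc _ ≤ S * |gauss.re - Real.exp (-N * u ^ 2)| + C * t * (S * ‖gauss‖) := by
        refine (abs_add_le _ _).trans (add_le_add ?_ ((abs_re_le_norm _).trans herror))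
        rw [abs_mul, abs_of_pos hS0]
    _ ≤ S * (3000 * t * (1 + (m * t) ^ 2) * Real.exp (-(N / 2) * u ^ 2)) +
        C * t * (S * (3 * Real.exp (-(N / 2) * u ^ 2) * (1 + (m * t) ^ 2))) := by
        gcongr
        · refine hmain.trans ?_
          gcongr
          rw [div_eq_mul_inv]
          gcongr
          exact inv_le_of_inv_le₀ ht hN
        · exact hnorm.trans (le_mul_of_one_le_right (by positivity)
            (le_add_of_nonneg_right (sq_nonneg _)))
    _ = _ := by ring

lemma norm_partitionGenFun_exp_neg_le : ∃ C : ℝ, 0 ≤ C ∧ ∀ t : ℝ, 0 < t → t ≤ 1 →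
    ‖partitionGenFun (Real.exp (-t))‖ ≤ C * (√(t / (2 * π)) * Real.exp (π ^ 2 / (6 * t))) := by
  obtain ⟨C, hC, hF⟩ := norm_partitionGenFun_sub_approx_le
  refine ⟨C + 1, by positivity, fun t ht ht1 => ?_⟩
  have happrox : ‖partitionGenFunApprox t‖ = √(t / (2 * π)) * Real.exp (π ^ 2 / (6 * t)) := by
    have h := partitionGenFunApprox_circlePoint ht 0
    simp only [circlePoint, ofReal_zero, zero_mul, add_zero, mul_one, log_one, zero_div, exp_zero,
      div_one] at h
    rw [h, norm_mul, norm_exp_ofReal, norm_real, Real.norm_of_nonneg (Real.sqrt_nonneg _)]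
  have hle := hF t (by simpa) (by simpa) (by simpa using (half_pos ht).le)
  rw [ofReal_re] at hle
  rw [ofReal_exp, ofReal_neg, ← happrox]
  calc ‖partitionGenFun (exp (-t))‖
      ≤ ‖partitionGenFun (exp (-t)) - partitionGenFunApprox t‖ + ‖partitionGenFunApprox t‖ := by
        simpa only [sub_add_cancel] using
          norm_add_le (partitionGenFun (exp (-t)) - partitionGenFunApprox t)
            (partitionGenFunApprox t)
    _ ≤ C * 1 * ‖partitionGenFunApprox t‖ + ‖partitionGenFunApprox t‖ := by
        gcongr
        exact hle.trans (by gcongr)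
    _ = (C + 1) * ‖partitionGenFunApprox t‖ := by ring

lemma le_norm_one_sub_exp_neg_circlePoint {t u : ℝ} (ht : 0 < t) (ht1 : t ≤ 1 / 2)
    (hu : 1 / 2 ≤ |u|) (hu1 : |u| ≤ π / t) :
    51 / 50 * (1 - Real.exp (-t)) ≤ ‖1 - exp (-circlePoint t u)‖ := by
  have hr1 : 1 - Real.exp (-t) ≤ t := by linarith [Real.add_one_le_exp (-t)]
  have hr0 : 0 ≤ 1 - Real.exp (-t) := by linarith [Real.exp_le_one_iff.2 (neg_nonpos.2 ht.le)]
  have hsq : ‖1 - exp (-circlePoint t u)‖ ^ 2 =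
      (1 - Real.exp (-t)) ^ 2 + 2 * Real.exp (-t) * (1 - Real.cos (t * u)) := by
    rw [Complex.sq_norm, normSq_apply, sub_re, sub_im, exp_re, exp_im, neg_re, neg_im,
      circlePoint_re, circlePoint_im, Real.cos_neg, Real.sin_neg, one_re, one_im]
    linear_combination Real.exp (-t) ^ 2 * Real.sin_sq_add_cos_sq (t * u)
  have hcos : t ^ 2 / 20 ≤ 1 - Real.cos (t * u) := by
    have hle := Real.cos_le_one_sub_mul_cos_sq (x := t * u) (by
      rw [abs_mul, abs_of_pos ht]
      rwa [le_div_iff₀ ht, mul_comm] at hu1)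
    have hu2 : 1 / 4 ≤ u ^ 2 := by
      rw [← sq_abs]
      nlinarith
    have hπ : π ^ 2 ≤ 10 := by nlinarith [Real.pi_lt_d2, Real.pi_pos]
    have hquad : t ^ 2 / 20 ≤ 2 / π ^ 2 * (t * u) ^ 2 := by
      rw [div_mul_eq_mul_div, div_le_div_iff₀ (by norm_num) (by positivity), mul_pow]
      nlinarith [mul_le_mul_of_nonneg_left hu2 (sq_nonneg t),
        mul_le_mul_of_nonneg_left hπ (sq_nonneg t)]
    linarith
  refine le_of_sq_le_sq ?_ (norm_nonneg _)
  rw [hsq, mul_pow]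
  have hr2 : 1 / 2 * (t ^ 2 / 20) ≤ Real.exp (-t) * (1 - Real.cos (t * u)) :=
    mul_le_mul (by linarith) hcos (by positivity) (Real.exp_nonneg _)
  nlinarith [pow_le_pow_left₀ hr0 hr1 2]

lemma inv_le_inv_one_sub_sub_re {t u : ℝ} (ht : 0 < t) (ht1 : t ≤ 1 / 2) (hu : 1 / 2 ≤ |u|)
    (hu1 : |u| ≤ π / t) :
    (51 * t)⁻¹ ≤ (1 - Real.exp (-t))⁻¹ - ((1 - exp (-circlePoint t u))⁻¹).re := by
  have hr : 0 < 1 - Real.exp (-t) := by linarith [Real.exp_lt_one_iff.2 (neg_lt_zero.2 ht)]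
  have hre : ((1 - exp (-circlePoint t u))⁻¹).re ≤ 50 / 51 * (1 - Real.exp (-t))⁻¹ :=
    calc _ ≤ ‖1 - exp (-circlePoint t u)‖⁻¹ := (re_le_norm _).trans_eq (norm_inv _)
      _ ≤ (51 / 50 * (1 - Real.exp (-t)))⁻¹ :=
        inv_anti₀ (by positivity) (le_norm_one_sub_exp_neg_circlePoint ht ht1 hu hu1)
      _ = 50 / 51 * (1 - Real.exp (-t))⁻¹ := by rw [mul_inv, inv_div]
  have hinv : t⁻¹ ≤ (1 - Real.exp (-t))⁻¹ :=
    inv_anti₀ hr (by linarith [Real.add_one_le_exp (-t)])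
  rw [mul_inv]
  linarith

lemma exp_neg_inv_le_pow_three {t : ℝ} (ht : 0 < t) :
    Real.exp (-(51 * t)⁻¹) ≤ 6 * 51 ^ 3 * t ^ 3 := by
  have hle := Real.pow_div_factorial_le_exp (51 * t)⁻¹ (by positivity) 3
  rw [Real.exp_neg]
  refine (inv_anti₀ (by positivity) hle).trans_eq ?_
  rw [inv_div, inv_pow, div_inv_eq_mul, mul_pow, ← mul_assoc]
  norm_num [Nat.factorial]

lemma norm_saddleIntegrand_le : ∃ C : ℝ, 0 ≤ C ∧ ∀ n m t u : ℝ, 0 < t → t ≤ 1 / 2 →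
    n * t = π ^ 2 / (6 * t) → 1 / 2 ≤ |u| → |u| ≤ π / t →
      ‖saddleIntegrand (n - m) t u‖ ≤ saddleSize t * Real.exp (-(m * t)) * (C * t ^ 3) := by
  obtain ⟨C, hC, hF⟩ := norm_partitionGenFun_exp_neg_le
  refine ⟨C * (6 * 51 ^ 3), by positivity, fun n m t u ht ht1 hn hu hu1 => ?_⟩
  have hle := norm_partitionGenFun_le (norm_exp_neg_circlePoint_lt_one ht u)
  rw [norm_exp_neg_circlePoint] at hle
  rw [saddleIntegrand, norm_mul, norm_exp_mul_circlePoint]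
  calc _ ≤ C * (√(t / (2 * π)) * Real.exp (π ^ 2 / (6 * t))) * (6 * 51 ^ 3 * t ^ 3) *
        Real.exp ((n - m) * t) := by
        gcongr
        refine hle.trans (mul_le_mul (hF t ht (by linarith)) ?_ (Real.exp_nonneg _)
          (by positivity))
        refine le_trans ?_ (exp_neg_inv_le_pow_three ht)
        gcongr
        exact inv_le_inv_one_sub_sub_re ht ht1 hu hu1
    _ = _ := by
        rw [sub_mul, hn, sub_eq_add_neg, Real.exp_add, saddleSize, two_mul (π ^ 2 / _),
          Real.exp_add (π ^ 2 / _)]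
        ring

lemma gaussian_le_of_half_le {t u : ℝ} (ht : 0 < t) (hu : 1 / 2 ≤ |u|) :
    Real.exp (-(π ^ 2 / (6 * t)) * u ^ 2) ≤
      8 * t * Real.exp (-(π ^ 2 / (6 * t) / 2) * u ^ 2) := by
  have hx : (8 * t)⁻¹ ≤ π ^ 2 / (6 * t) / 2 * u ^ 2 := by
    have hN := inv_le_pi_sq_div ht
    have hu2 : 1 / 4 ≤ u ^ 2 := by
      rw [← sq_abs]
      nlinarith
    rw [mul_inv]
    nlinarith [inv_pos.2 ht]
  have hexp : Real.exp (-(π ^ 2 / (6 * t) / 2 * u ^ 2)) ≤ 8 * t := by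
    rw [Real.exp_neg]
    refine inv_le_of_inv_le₀ (by positivity) ?_
    linarith [Real.add_one_le_exp (π ^ 2 / (6 * t) / 2 * u ^ 2)]
  calc _ = Real.exp (-(π ^ 2 / (6 * t) / 2 * u ^ 2)) *
        Real.exp (-(π ^ 2 / (6 * t) / 2) * u ^ 2) := by
        rw [← Real.exp_add]
        ring_nf
    _ ≤ _ := by gcongr

end SaddleEstimates

section ShiftedCard

open MeasureTheory Set
open scoped Real

lemma abs_saddleIntegrand_sub_gaussian_le_of_half_le : ∃ C : ℝ, 0 ≤ C ∧ ∀ n m t u : ℝ, 0 < t →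
    t ≤ 1 / 2 → n * t = π ^ 2 / (6 * t) → 1 / 2 ≤ |u| → |u| ≤ π / t →
      |(saddleIntegrand (n - m) t u).re -
        saddleSize t * Real.exp (-(m * t)) * Real.exp (-(π ^ 2 / (6 * t)) * u ^ 2)| ≤
      saddleSize t * Real.exp (-(m * t)) * (C * t) *
        (Real.exp (-(π ^ 2 / (6 * t) / 2) * u ^ 2) + t ^ 2) := by
  obtain ⟨C, hC, hnorm⟩ := norm_saddleIntegrand_le
  refine ⟨C + 8, by positivity, fun n m t u ht ht1 hn hu hu1 => ?_⟩
  have hintegrand := (Complex.abs_re_le_norm _).trans (hnorm n m t u ht ht1 hn hu hu1)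
  have hgauss := gaussian_le_of_half_le ht hu
  set S := saddleSize t * Real.exp (-(m * t))
  have hS : 0 < S := mul_pos (saddleSize_pos ht) (Real.exp_pos _)
  set E := Real.exp (-(π ^ 2 / (6 * t) / 2) * u ^ 2)
  have : 0 < E := Real.exp_pos _
  calc _ ≤ S * (C * t ^ 3) + S * (8 * t * E) := by
        refine (abs_sub _ _).trans (add_le_add hintegrand ?_)
        rw [abs_of_pos (by positivity)]
        gcongr
    _ = S * t * (C * t ^ 2 + 8 * E) := by ring
    _ ≤ S * t * ((C + 8) * t ^ 2 + (C + 8) * E) := by gcongr <;> linarith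
    _ = _ := by ring

lemma half_le_abs_of_notMem_Ioc {t u : ℝ} (ht : 0 < t) (ht1 : t ≤ 1)
    (hu : u ∉ Ioc (-(π / t)) (π / t)) : 1 / 2 ≤ |u| := by
  have hπ : 1 / 2 < π / t := by
    rw [div_lt_div_iff₀ two_pos ht]
    linarith [Real.pi_gt_three]
  by_contra! hlt
  exact hu ⟨by linarith [(abs_lt.1 hlt).1], by linarith [(abs_lt.1 hlt).2]⟩

lemma abs_indicator_saddleIntegrand_sub_gaussian_le : ∃ C : ℝ, 0 ≤ C ∧ ∀ n m t u : ℝ, 0 < t →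
    t ≤ 1 / 2 → n * t = π ^ 2 / (6 * t) →
      |(Ioc (-(π / t)) (π / t)).indicator (fun v => (saddleIntegrand (n - m) t v).re) u -
        saddleSize t * Real.exp (-(m * t)) * Real.exp (-(π ^ 2 / (6 * t)) * u ^ 2)| ≤
      saddleSize t * Real.exp (-(m * t)) * (C * t * (1 + (m * t) ^ 2)) *
        (Real.exp (-(π ^ 2 / (6 * t) / 2) * u ^ 2) +
          t ^ 2 * (Ioc (-(π / t)) (π / t)).indicator 1 u) := by
  obtain ⟨C₁, hC₁, hnear⟩ := abs_saddleIntegrand_sub_gaussian_le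
  obtain ⟨C₂, hC₂, hfar⟩ := abs_saddleIntegrand_sub_gaussian_le_of_half_le
  refine ⟨C₁ + C₂ + 8, by positivity, fun n m t u ht ht1 hn => ?_⟩
  have hgauss := gaussian_le_of_half_le (u := u) ht
  have hJnear := hnear n m t u ht (by linarith) hn
  have hJfar := hfar n m t u ht ht1 hn
  set S := saddleSize t * Real.exp (-(m * t))
  have hS : 0 < S := mul_pos (saddleSize_pos ht) (Real.exp_pos _)
  set P := 1 + (m * t) ^ 2
  have hP : 1 ≤ P := le_add_of_nonneg_right (sq_nonneg _)
  set E := Real.exp (-(π ^ 2 / (6 * t) / 2) * u ^ 2)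
  have : 0 < E := Real.exp_pos _
  by_cases hu : u ∈ Ioc (-(π / t)) (π / t)
  · rw [indicator_of_mem hu, indicator_of_mem hu, Pi.one_apply, mul_one]
    rcases le_total |u| (1 / 2) with h | h
    · calc _ ≤ S * (C₁ * t * P * E) := hJnear h
        _ ≤ S * ((C₁ + C₂ + 8) * t * P * (E + t ^ 2)) := by
          gcongr <;> linarith [sq_nonneg t]
        _ = _ := by ring
    · calc _ ≤ S * (C₂ * t * 1) * (E + t ^ 2) := by
            simpa only [mul_one] using hJfar h (abs_le.2 ⟨hu.1.le, hu.2⟩)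
        _ ≤ _ := by gcongr; linarith
  · rw [indicator_of_notMem hu, indicator_of_notMem hu, mul_zero, add_zero, zero_sub, abs_neg,
      abs_of_pos (mul_pos hS (Real.exp_pos _))]
    calc _ ≤ S * (8 * t * E) := by
          gcongr
          exact hgauss (half_le_abs_of_notMem_Ioc ht (by linarith) hu)
      _ = S * (8 * t * 1) * E := by ring
      _ ≤ _ := by gcongr; linarith

/-- The contribution of the saddle point to Cauchy's formula for the number of partitions. -/
noncomputable def saddleTerm (t : ℝ) : ℝ :=
  t / (2 * π) * (saddleSize t * √(π / (π ^ 2 / (6 * t))))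

lemma saddleTerm_pos {t : ℝ} (ht : 0 < t) : 0 < saddleTerm t := by
  have := saddleSize_pos ht
  unfold saddleTerm
  positivity

lemma integral_indicator_saddleIntegrand (n m : ℕ) {t : ℝ} (ht : 0 < t) :
    ∫ u, (Ioc (-(π / t)) (π / t)).indicator (fun v => (saddleIntegrand (n - m) t v).re) u =
      shiftedCard n m * (2 * π / t) := by
  rw [integral_indicator measurableSet_Ioc,
    ← intervalIntegral.integral_of_le (neg_le_self (by positivity))]
  refine (Complex.reCLM.intervalIntegral_comp_comm
    ((continuous_saddleIntegrand _ ht).intervalIntegrable _ _)).trans ?_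
  rw [integral_saddleIntegrand n m ht, Complex.reCLM_apply]
  exact_mod_cast Complex.ofReal_re (shiftedCard n m * (2 * π / t))

lemma integrable_indicator_one_Ioc (a b : ℝ) : Integrable ((Ioc a b).indicator (1 : ℝ → ℝ)) :=
  (integrable_indicator_iff measurableSet_Ioc).2 continuous_one.integrableOn_Ioc

lemma integral_gaussian_add_indicator {t : ℝ} (ht : 0 < t) :
    ∫ u, (Real.exp (-(π ^ 2 / (6 * t) / 2) * u ^ 2) +
      t ^ 2 * (Ioc (-(π / t)) (π / t)).indicator 1 u) =
      √(π / (π ^ 2 / (6 * t) / 2)) + 2 * π * t := by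
  rw [integral_add (integrable_exp_neg_mul_sq (by positivity))
    ((integrable_indicator_one_Ioc _ _).const_mul _), integral_gaussian, integral_const_mul,
    integral_indicator_one measurableSet_Ioc,
    Real.volume_real_Ioc_of_le (neg_le_self (by positivity))]
  field_simp
  ring

lemma sqrt_gaussian_add_le {t : ℝ} (ht : 0 < t) (ht1 : t ≤ 1) :
    √(π / (π ^ 2 / (6 * t) / 2)) + 2 * π * t ≤
      (2 + 2 * π) * √(π / (π ^ 2 / (6 * t))) := by
  have hsqrt : √(π / (π ^ 2 / (6 * t) / 2)) ≤ 2 * √(π / (π ^ 2 / (6 * t))) := by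
    rw [div_div_eq_mul_div, mul_comm π 2, mul_div_assoc, Real.sqrt_mul two_pos.le]
    gcongr
    exact Real.sqrt_le_iff.2 ⟨two_pos.le, by norm_num⟩
  have ht_le : t ≤ √(π / (π ^ 2 / (6 * t))) := by
    refine Real.le_sqrt_of_sq_le ?_
    have hπt : π * t ≤ 6 := by nlinarith [Real.pi_lt_four, Real.pi_pos]
    have hrw : π / (π ^ 2 / (6 * t)) = 6 * t / π := by field_simp
    rw [hrw, le_div_iff₀ Real.pi_pos]
    nlinarith
  nlinarith [Real.pi_pos]

lemma abs_shiftedCard_sub_saddleTerm_le : ∃ C : ℝ, 0 ≤ C ∧ ∀ (n m : ℕ) (t : ℝ), 0 < t →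
    t ≤ 1 / 2 → n * t = π ^ 2 / (6 * t) →
      |shiftedCard n m - saddleTerm t * Real.exp (-(m * t))| ≤
        C * t * (1 + (m * t) ^ 2) * (saddleTerm t * Real.exp (-(m * t))) := by
  obtain ⟨C, hC, hpointwise⟩ := abs_indicator_saddleIntegrand_sub_gaussian_le
  refine ⟨C * (2 + 2 * π), by positivity, fun n m t ht ht1 hn => ?_⟩
  have hint : Integrable
      ((Ioc (-(π / t)) (π / t)).indicator fun v => (saddleIntegrand (n - m) t v).re) :=
    (integrable_indicator_iff measurableSet_Ioc).2
      (Complex.continuous_re.comp (continuous_saddleIntegrand _ ht)).integrableOn_Ioc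
  have hgauss : Integrable fun u : ℝ => Real.exp (-(π ^ 2 / (6 * t)) * u ^ 2) :=
    integrable_exp_neg_mul_sq (by positivity)
  have hbound := norm_integral_le_of_norm_le
    (((integrable_exp_neg_mul_sq (half_pos (by positivity))).fun_add
      ((integrable_indicator_one_Ioc _ _).const_mul _)).const_mul _)
    (Eventually.of_forall fun u =>
      (Real.norm_eq_abs _).trans_le (hpointwise n m t u ht ht1 hn))
  rw [integral_sub hint (hgauss.const_mul _), integral_indicator_saddleIntegrand n m ht,
    integral_const_mul, integral_gaussian, integral_const_mul, integral_gaussian_add_indicator ht,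
    Real.norm_eq_abs] at hbound
  have hsize := saddleSize_pos ht
  set G := √(π / (π ^ 2 / (6 * t)))
  have hterm : saddleTerm t = t / (2 * π) * (saddleSize t * G) := rfl
  calc |shiftedCard n m - saddleTerm t * Real.exp (-(m * t))|
      = t / (2 * π) * |shiftedCard n m * (2 * π / t) -
          saddleSize t * Real.exp (-(m * t)) * G| := by
        rw [← abs_of_pos (by positivity : 0 < t / (2 * π)), ← abs_mul, hterm]
        congr 1
        field_simp
    _ ≤ t / (2 * π) * (saddleSize t * Real.exp (-(m * t)) * (C * t * (1 + (m * t) ^ 2)) *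
          ((2 + 2 * π) * G)) := by
        gcongr
        exact hbound.trans (by gcongr; exact sqrt_gaussian_add_le ht (by linarith))
    _ = _ := by
        rw [hterm]
        ring

lemma one_add_sq_le_exp_half {w : ℝ} (hw : 0 ≤ w) : 1 + w ^ 2 ≤ 8 * Real.exp (w / 2) := by
  have := Real.quadratic_le_exp_of_nonneg (div_nonneg hw two_pos.le)
  nlinarith

lemma abs_shiftedCard_sub_saddleTerm_mul_pow_le : ∃ C : ℝ, 0 ≤ C ∧ ∀ (n : ℕ) (t : ℝ), 0 < t →
    t ≤ 1 / 2 → n * t = π ^ 2 / (6 * t) → ∀ m : ℕ,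
      |shiftedCard n m - saddleTerm t * Real.exp (-t) ^ m| ≤
        C * t * saddleTerm t * Real.exp (-(t / 2)) ^ m := by
  obtain ⟨C, hC, hshift⟩ := abs_shiftedCard_sub_saddleTerm_le
  refine ⟨C * 8, by positivity, fun n t ht ht1 hn m => ?_⟩
  have hterm := saddleTerm_pos ht
  have hexp : Real.exp (m * t / 2) * Real.exp (-(m * t)) = Real.exp (-(m * t / 2)) := by
    rw [← Real.exp_add]
    ring_nf
  rw [← Real.exp_nat_mul, ← Real.exp_nat_mul, mul_neg, mul_neg, ← mul_div_assoc]
  calc _ ≤ C * t * (1 + (m * t) ^ 2) * (saddleTerm t * Real.exp (-(m * t))) :=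
        hshift n m t ht ht1 hn
    _ ≤ C * t * (8 * Real.exp (m * t / 2)) * (saddleTerm t * Real.exp (-(m * t))) := by
        gcongr
        exact one_add_sq_le_exp_half (by positivity)
    _ = C * 8 * t * saddleTerm t * (Real.exp (m * t / 2) * Real.exp (-(m * t))) := by ring
    _ = _ := by rw [hexp]

end ShiftedCard

section Assembly

open scoped Topology Real

lemma hasSum_coeff_completeBell_sigmaSeries (k : ℕ) {t : ℝ} (ht : 0 < t) :
    HasSum (fun m => ((PowerSeries.coeff m (completeBell sigmaSeries k) : ℕ) : ℝ) *
      Real.exp (-t) ^ m) (completeBell (lambert · t) k) := by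
  have hlambert (i : ℕ) : AbsHasSum ((sigmaSeries i).map (Nat.castRingHom ℝ)) (Real.exp (-t))
      (lambert i t) := by
    have hsum := summable_sigma_mul_exp_neg_pow i ht
    simp only [AbsHasSum, PowerSeries.coeff_map, sigmaSeries, PowerSeries.coeff_mk, eq_natCast]
    exact ⟨hsum.norm, hsum.hasSum⟩
  have hbell := (AbsHasSum.completeBell hlambert k).2
  rw [← map_completeBell] at hbell
  simpa only [PowerSeries.coeff_map, eq_natCast] using hbell

lemma hasSum_moment (k n : ℕ) :
    HasSum (fun m => ((PowerSeries.coeff m (completeBell sigmaSeries k) : ℕ) : ℝ) *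
      shiftedCard n m) (moment k n) := by
  have hsum : (moment k n : ℝ) = ∑ m ∈ Finset.range (n + 1),
      ((PowerSeries.coeff m (completeBell sigmaSeries k) : ℕ) : ℝ) * shiftedCard n m := by
    rw [moment_eq_sum_coeff, Nat.cast_sum]
    refine Finset.sum_congr rfl fun m hm => ?_
    rw [shiftedCard, if_pos (Finset.mem_range_succ_iff.1 hm), Nat.cast_mul]
  rw [hsum]
  refine hasSum_sum_of_ne_finset_zero fun m hm => ?_
  rw [shiftedCard, if_neg (by simpa using hm), Nat.cast_zero, mul_zero]

lemma abs_moment_sub_le : ∃ C : ℝ, 0 ≤ C ∧ ∀ (k n : ℕ) (t : ℝ), 0 < t → t ≤ 1 / 2 →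
    n * t = π ^ 2 / (6 * t) →
      |moment k n - saddleTerm t * completeBell (lambert · t) k| ≤
        C * t * saddleTerm t * completeBell (lambert · (t / 2)) k := by
  obtain ⟨C, hC, hshift⟩ := abs_shiftedCard_sub_saddleTerm_mul_pow_le
  refine ⟨C, hC, fun k n t ht ht1 hn => ?_⟩
  have hmain := (hasSum_coeff_completeBell_sigmaSeries k ht).mul_left (saddleTerm t)
  have herror := (hasSum_coeff_completeBell_sigmaSeries k (half_pos ht)).mul_left
    (C * t * saddleTerm t)
  refine ((hasSum_moment k n).sub hmain).norm_le_of_bounded herror fun m => ?_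
  rw [mul_left_comm, ← mul_sub, norm_mul, Real.norm_of_nonneg (Nat.cast_nonneg _), mul_left_comm]
  exact mul_le_mul_of_nonneg_left (hshift n t ht ht1 hn m) (Nat.cast_nonneg _)

lemma isBigO_completeBell_lambert_sub (k : ℕ) :
    (fun t => completeBell (lambert · t) k - t⁻¹ ^ k * completeBell (zetaArg t) k) =O[𝓝[>] 0]
      fun t => t * (t⁻¹ ^ k * completeBell (zetaArg t) k) := by
  have hpos : ∀ᶠ t in 𝓝[>] (0 : ℝ), ∀ i, 0 < zetaArg t i :=
    eventually_one_le_zetaArg.mono fun t h i => one_pos.trans_le (h i)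
  have hsub := isBigO_completeBell_sub (x := fun i t => zetaArg t i)
    (y := fun i t => t ^ (i + 1) * lambert i t) hpos
    ((tendsto_id.mono_left nhdsWithin_le_nhds).isBigO_one ℝ) isBigO_lambert_sub_zetaArg k
  refine ((isBigO_refl (fun t : ℝ => t⁻¹ ^ k) _).mul hsub).congr' ?_ ?_
  · refine eventually_nhdsWithin_of_forall fun t (ht : 0 < t) => ?_
    simp only [completeBell_pow_mul, mul_sub, ← mul_assoc, ← mul_pow, inv_mul_cancel₀ ht.ne',
      one_pow, one_mul]
  · exact Eventually.of_forall fun t => mul_left_comm _ _ _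

lemma isBigO_completeBell_lambert_half (k : ℕ) :
    (fun t => completeBell (lambert · (t / 2)) k) =O[𝓝[>] 0]
      fun t => t⁻¹ ^ k * completeBell (zetaArg t) k := by
  have hpos : ∀ᶠ t in 𝓝[>] (0 : ℝ), ∀ i, 0 < zetaArg t i :=
    eventually_one_le_zetaArg.mono fun t h i => one_pos.trans_le (h i)
  have hle := isBigO_completeBell (x := fun i t => zetaArg t i)
    (y := fun i t => t ^ (i + 1) * lambert i (t / 2)) hpos isBigO_pow_mul_lambert_half k
  refine ((isBigO_refl (fun t : ℝ => t⁻¹ ^ k) _).mul hle).congr' ?_ EventuallyEq.rfl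
  refine eventually_nhdsWithin_of_forall fun t (ht : 0 < t) => ?_
  simp only [completeBell_pow_mul, ← mul_assoc, ← mul_pow, inv_mul_cancel₀ ht.ne', one_pow, one_mul]

/-- The saddle point of `exp (x * t + π ^ 2 / (6 * t))`. -/
noncomputable def saddlePoint (x : ℝ) : ℝ := π / √(6 * x)

lemma saddlePoint_pos {x : ℝ} (hx : 0 < x) : 0 < saddlePoint x := by
  unfold saddlePoint
  positivity

lemma mul_saddlePoint {x : ℝ} (hx : 0 < x) :
    x * saddlePoint x = π ^ 2 / (6 * saddlePoint x) := by
  have hsq := Real.sq_sqrt (show 0 ≤ 6 * x by positivity)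
  have hpos : 0 < √(6 * x) := by positivity
  unfold saddlePoint
  generalize √(6 * x) = s at hsq hpos ⊢
  field_simp
  linarith

lemma two_mul_mul_saddlePoint {x : ℝ} (hx : 0 < x) :
    2 * (x * saddlePoint x) = π * √(2 * x / 3) := by
  have hsqrt : √(2 * x / 3) = √(6 * x) / 3 := by
    rw [show 2 * x / 3 = 6 * x / 3 ^ 2 by ring, Real.sqrt_div' _ (by norm_num),
      Real.sqrt_sq (by norm_num)]
  have hsq := Real.sq_sqrt (show 0 ≤ 6 * x by positivity)
  have hpos : 0 < √(6 * x) := by positivity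
  rw [hsqrt, saddlePoint]
  generalize √(6 * x) = s at hsq hpos ⊢
  field_simp
  linarith

lemma saddleTerm_saddlePoint {x : ℝ} (hx : 0 < x) :
    saddleTerm (saddlePoint x) = 1 / (4 * √3 * x) * Real.exp (π * √(2 * x / 3)) := by
  have ht := saddlePoint_pos hx
  have hscale : saddlePoint x / (2 * π) * (π / (x * saddlePoint x)) = 3 / (6 * x) := by
    field_simp
    norm_num
  have hsq3 := Real.sq_sqrt (show (0 : ℝ) ≤ 3 by norm_num)
  have hsq := Real.sq_sqrt (show 0 ≤ 6 * x by positivity)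
  have : 0 < √(6 * x) := by positivity
  rw [saddleTerm, saddleSize, ← mul_saddlePoint hx, two_mul_mul_saddlePoint hx,
    mul_right_comm √_, ← Real.sqrt_mul (by positivity), ← mul_assoc, hscale,
    Real.sqrt_div (by norm_num), saddlePoint]
  congr 1
  field_simp
  rw [hsq, hsq3]
  ring

lemma saddlePoint_eq_rpow (n : ℕ) :
    saddlePoint n = π / √6 * (n : ℝ) ^ (-(1 / 2) : ℝ) := by
  rw [saddlePoint, Real.sqrt_mul (by norm_num), Real.rpow_neg (Nat.cast_nonneg n),
    ← Real.sqrt_eq_rpow, div_mul_eq_div_div, div_eq_mul_inv]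

lemma tendsto_saddlePoint : Tendsto (fun n : ℕ => saddlePoint n) atTop (𝓝[>] 0) := by
  refine tendsto_nhdsWithin_iff.2 ⟨?_, (eventually_gt_atTop 0).mono fun n hn =>
    saddlePoint_pos (Nat.cast_pos.2 hn)⟩
  have hrpow : Tendsto (fun n : ℕ => (n : ℝ) ^ (-(1 / 2) : ℝ)) atTop (𝓝 0) :=
    (tendsto_rpow_neg_atTop (by norm_num)).comp tendsto_natCast_atTop_atTop
  simpa [saddlePoint_eq_rpow] using hrpow.const_mul (π / √6)

lemma isBigO_moment_sub (k : ℕ) :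
    (fun n : ℕ => moment k n - saddleTerm (saddlePoint n) *
      ((saddlePoint n)⁻¹ ^ k * completeBell (zetaArg (saddlePoint n)) k)) =O[atTop]
      fun n : ℕ => saddlePoint n * (saddleTerm (saddlePoint n) *
        ((saddlePoint n)⁻¹ ^ k * completeBell (zetaArg (saddlePoint n)) k)) := by
  obtain ⟨C, hC, hmoment⟩ := abs_moment_sub_le
  have hcauchy : (fun n : ℕ => moment k n -
      saddleTerm (saddlePoint n) * completeBell (lambert · (saddlePoint n)) k) =O[atTop]
      fun n : ℕ => saddlePoint n * (saddleTerm (saddlePoint n) *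
        completeBell (lambert · (saddlePoint n / 2)) k) := by
    refine IsBigO.of_bound C ?_
    have hsmall := (tendsto_saddlePoint.mono_right nhdsWithin_le_nhds).eventually_le_const
      one_half_pos
    filter_upwards [hsmall, eventually_gt_atTop 0] with n hle hn
    have hn : (0 : ℝ) < n := Nat.cast_pos.2 hn
    refine (hmoment k n _ (saddlePoint_pos hn) hle (mul_saddlePoint hn)).trans ?_
    rw [mul_assoc, mul_assoc C]
    exact mul_le_mul_of_nonneg_left (le_abs_self _) hC
  have hterm := isBigO_refl (fun n : ℕ => saddleTerm (saddlePoint n)) atTop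
  have hhalf := (isBigO_completeBell_lambert_half k).comp_tendsto tendsto_saddlePoint
  have hsub := (isBigO_completeBell_lambert_sub k).comp_tendsto tendsto_saddlePoint
  refine ((hcauchy.trans ((isBigO_refl _ _).mul (hterm.mul hhalf))).add
    ((hterm.mul hsub).congr_right fun n => mul_left_comm _ _ _)).congr_left fun n => ?_
  simp only [Function.comp_apply]
  ring

lemma eqOneAddBigO_of_isBigO {f g : ℕ → ℝ} (hg : ∀ᶠ n in atTop, g n ≠ 0)
    (h : (fun n => f n - g n) =O[atTop] fun n : ℕ => (n : ℝ) ^ (-(1 / 2) : ℝ) * g n) :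
    EqOneAddBigO f g := by
  refine ⟨fun n => (f n - g n) / g n, ?_, hg.mono fun n hn => ?_⟩
  · have hdiv := h.mul (isBigO_refl (fun n => (g n)⁻¹) atTop)
    refine hdiv.congr' (Eventually.of_forall fun n => (div_eq_mul_inv _ _).symm) ?_
    exact hg.mono fun n hn => mul_inv_cancel_right₀ hn _
  · rw [mul_add, mul_div_cancel₀ _ hn]
    ring

lemma bellSum_zetaArgs (k n : ℕ) :
    bellSum k (zetaArgs k n) = completeBell (zetaArg (saddlePoint n)) k := by
  rw [← bellSum_eq_completeBell]
  congr 1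
  funext i
  rcases i with ⟨_ | i, hi⟩
  · rw [zetaArgs, if_pos rfl, zetaArg_zero, saddlePoint, ← inv_div, Real.log_inv, sub_eq_add_neg]
  · rw [zetaArgs, if_neg (by simp), zetaArg_succ]

lemma bellSum_one (x : Fin 1 → ℝ) : bellSum 1 x = x 0 := by
  have hx : x = fun _ => x 0 := funext fun i => by rw [Subsingleton.elim i 0]
  rw [hx, bellSum_eq_completeBell 1 fun _ => x 0]
  simp [completeBell_succ]

lemma zetaArgs_zero (n : ℕ) :
    zetaArgs 1 n 0 = Real.eulerMascheroniConstant + Real.log (√(6 * (n : ℝ)) / π) :=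
  if_pos rfl

lemma sqrt_two_div_eq {x : ℝ} (hx : 0 ≤ x) :
    √2 / (4 * π * √x) = 1 / (4 * √3 * x) * (√(6 * x) / π) := by
  rcases hx.eq_or_lt with rfl | hx
  · simp
  have hsix : √(6 * x) = √2 * √3 * √x := by
    rw [← Real.sqrt_mul (by norm_num), ← Real.sqrt_mul (by norm_num)]
    norm_num
  rw [hsix]
  field_simp
  rw [Real.sq_sqrt hx.le]

end Assembly

end PartitionMoments

open PartitionMoments in
open scoped Real in
theorem mainTheorem8_general (k : ℕ) :
    EqOneAddBigO (fun n => (moment k n : ℝ)) (fun n =>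
      1 / (4 * √3 * (n : ℝ)) * Real.exp (π * √(2 * (n : ℝ) / 3)) * (√(6 * (n : ℝ)) / π) ^ k *
        bellSum k (zetaArgs k n)) := by
  have hmain : (fun n : ℕ => saddleTerm (saddlePoint n) *
      ((saddlePoint n)⁻¹ ^ k * completeBell (zetaArg (saddlePoint n)) k)) =ᶠ[atTop] fun n =>
      1 / (4 * √3 * (n : ℝ)) * Real.exp (π * √(2 * (n : ℝ) / 3)) * (√(6 * (n : ℝ)) / π) ^ k *
        bellSum k (zetaArgs k n) := by
    filter_upwards [eventually_gt_atTop 0] with n hn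
    rw [saddleTerm_saddlePoint (Nat.cast_pos.2 hn), bellSum_zetaArgs, mul_assoc _ (_ ^ k),
      ← inv_div π, saddlePoint]
  refine eqOneAddBigO_of_isBigO ?_ ?_
  · filter_upwards [hmain, eventually_gt_atTop 0,
      tendsto_saddlePoint.eventually eventually_one_le_zetaArg] with n hn hpos hone
    rw [← hn]
    have ht := saddlePoint_pos (Nat.cast_pos.2 hpos)
    have hterm := saddleTerm_pos ht
    have hbell := completeBell_pos (fun i => one_pos.trans_le (hone i)) k
    positivity
  · refine (((isBigO_moment_sub k).congr' (EventuallyEq.rfl.sub hmain)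
      (EventuallyEq.rfl.mul hmain)).trans (.mul ?_ (isBigO_refl _ _)))
    simp only [saddlePoint_eq_rpow]
    exact isBigO_const_mul_self _ _ _

theorem mainTheorem8 :
    PartitionMoments.EqOneAddBigO
      (fun n => (PartitionMoments.moment 1 n : ℝ))
      (fun n => Real.sqrt 2 / (4 * Real.pi * Real.sqrt (n : ℝ)) *
        Real.exp (Real.pi * Real.sqrt (2 * (n : ℝ) / 3)) *
        (Real.eulerMascheroniConstant + Real.log (Real.sqrt (6 * (n : ℝ)) / Real.pi))) ∧
    ∀ k : ℕ, 2 ≤ k →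
      PartitionMoments.EqOneAddBigO
        (fun n => (PartitionMoments.moment k n : ℝ))
        (fun n => 1 / (4 * Real.sqrt 3 * (n : ℝ)) *
          Real.exp (Real.pi * Real.sqrt (2 * (n : ℝ) / 3)) *
          (Real.sqrt (6 * (n : ℝ)) / Real.pi) ^ k *
          PartitionMoments.bellSum k (PartitionMoments.zetaArgs k n)) := by
  refine ⟨?_, fun k _ => mainTheorem8_general k⟩
  simpa only [PartitionMoments.sqrt_two_div_eq (Nat.cast_nonneg _), PartitionMoments.bellSum_one,
    PartitionMoments.zetaArgs_zero, pow_one, mul_right_comm] using mainTheorem8_general 1
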